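/- Let $d\ge 1$, let $\Omega\subset\mathbb{R}^d$ be a bounded domain (nonempty, open, connected) with $C^\infty$ boundary, $\nu$ the unit outer normal to $\partial\Omega$ and $d\sigma$ the volume element of $\partial\Omega$. Let $\tau>0$, $c_0\in(\tfrac1{\sqrt2},1)$, and put $Q_\tau:=\Omega\times(0,\tau)$, $\Sigma_\tau:=\partial\Omega\times(0,\tau)$. Let $H\in C^1([0,\tau];\mathbb{R}^d)$, and suppose that there are $\rho>0$ and $\theta_0\in\mathbb{R}^d$ with $|\theta_0|=1$ such that $$|H(t)|\ge\rho\quad\text{and}\quad \frac{H(t)\cdot\theta_0}{|H(t)|}\ge c_0\qquad\text{for all }t\in[0,\tau].$$ Let $x_0\in\mathbb{R}^d\setminus\overline\Omega$ satisfy $$\frac{H(t)\cdot(x-x_0)}{|H(t)|\,|x-x_0|}\ge 2c_0^2-1\qquad\text{for all }(x,t)\in\overline\Omega\times[0,\tau],$$ and let $\psi(x,t):=|x-x_0|^2-\beta t$, where $$0<\beta<2\delta,\qquad \delta:=\rho\,(2c_0^2-1)\,\mathrm{dist}(x_0,\Omega).$$ Write $Au:=\partial_tu+H(t)\cdot\nabla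 u$. Then there exist constants $s_*>0$, $C>0$ and $C'>0$ such that, for all $s>s_*$ and all real-valued $u\in H^1(Q_\tau)$, $$s^2\int_{Q_\tau}e^{2s\psi}|u|^2\,dx\,dt\le C\int_{Q_\tau}e^{2s\psi}|Au|^2\,dx\,dt+Cs\int_{\Sigma_\tau}e^{2s\psi}\,A\psi\,(H(t)\cdot\nu(x))\,|u|^2\,d\sigma\,dt+C's\int_\Omega e^{2s\psi(x,\tau)}|u(x,\tau)|^2\,dx.$$ Here the derivatives in $Au$ are weak derivatives, and the values of $u$ on $\Sigma_\tau$ and at $t=\tau$ are the traces of $u$, i.e. the $L^2$-limits of the restrictions of smooth functions on $\mathbb{R}^d\times\mathbb{R}$ that converge to $u$ in $H^1(Q_\tau)$. -/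

import Mathlib

open MeasureTheory Filter Set
open scoped Topology ContDiff RealInnerProductSpace

noncomputable section

namespace CarlemanTransport

/-- The Euclidean space `ℝ^d`. -/
abbrev Space (d : ℕ) : Type := EuclideanSpace ℝ (Fin d)

/-- Space-time `ℝ^d × ℝ`; a point is `p = (x, t)`. Only its product topology, its linear structure
and its Lebesgue measure are used below. -/
abbrev SpaceTime (d : ℕ) : Type := Space d × ℝ

/-- `Ω` has smooth (`C^∞`) boundary: near each boundary point, for a suitable unit vector `e`, the
set `Ω` is the region lying below the graph, in the direction `e`, of a smooth function `γ` of the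
variables orthogonal to `e` (i.e. of a smooth function that is constant along `e`). -/
def HasSmoothBoundary {d : ℕ} (Ω : Set (Space d)) : Prop :=
  ∀ p ∈ frontier Ω, ∃ U : Set (Space d), IsOpen U ∧ p ∈ U ∧
    ∃ (e : Space d) (γ : Space d → ℝ), ‖e‖ = 1 ∧ ContDiff ℝ ∞ γ ∧
      (∀ (x : Space d) (r : ℝ), γ (x + r • e) = γ x) ∧
      Ω ∩ U = {x | x ∈ U ∧ ⟪x, e⟫ < γ x}

/-- A bounded domain (nonempty connected open set) of `ℝ^d` with smooth boundary. -/
structure IsSmoothBoundedDomain {d : ℕ} (Ω : Set (Space d)) : Prop where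
  isOpen : IsOpen Ω
  isConnected : IsConnected Ω
  isBounded : Bornology.IsBounded Ω
  smoothBoundary : HasSmoothBoundary Ω

/-- `n` is a unit outer normal to `Ω` at `p`: a unit vector such that every direction making an
obtuse angle with `n` enters `Ω` at `p`, and every direction making an acute angle with `n` leaves
the closure of `Ω` at `p`. At most one vector has this property. -/
def IsOuterUnitNormal {d : ℕ} (Ω : Set (Space d)) (p n : Space d) : Prop :=
  ‖n‖ = 1 ∧
    (∀ v : Space d, ⟪v, n⟫ < 0 → ∀ᶠ r : ℝ in 𝓝[>] 0, p + r • v ∈ Ω) ∧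
    (∀ v : Space d, 0 < ⟪v, n⟫ → ∀ᶠ r : ℝ in 𝓝[>] 0, p + r • v ∉ closure Ω)

open Classical in
/-- The unit outer normal `ν(p)` (zero where there is none, which does not happen at a boundary
point of a domain with smooth boundary). -/
def outerNormal {d : ℕ} (Ω : Set (Space d)) (p : Space d) : Space d :=
  if h : ∃ n, IsOuterUnitNormal Ω p n then h.choose else 0

/-- The volume element `dσ` of `∂Ω`: the `(d-1)`-dimensional Euclidean Hausdorff measure (the one
normalized to agree with Lebesgue measure in dimension `d-1`) on the boundary. -/
def surfaceMeasure {d : ℕ} (Ω : Set (Space d)) : Measure (Space d) :=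
  (μHE[d - 1] : Measure (Space d)).restrict (frontier Ω)

/-- The cylinder `Q_τ = Ω × (0, τ)`. -/
def spaceTimeCylinder {d : ℕ} (Ω : Set (Space d)) (τ : ℝ) : Set (SpaceTime d) := Ω ×ˢ Ioo 0 τ

/-- The measure `dσ dt` on the lateral boundary `Σ_τ = ∂Ω × (0, τ)`. -/
def lateralMeasure {d : ℕ} (Ω : Set (Space d)) (τ : ℝ) : Measure (SpaceTime d) :=
  (surfaceMeasure Ω).prod (volume.restrict (Ioo 0 τ))

/-- Classical gradient in the space variable. -/
def spaceGrad {d : ℕ} (f : SpaceTime d → ℝ) (p : SpaceTime d) : Space d :=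
  gradient (fun x => f (x, p.2)) p.1

/-- Classical derivative in the time variable. -/
def timeDeriv {d : ℕ} (f : SpaceTime d → ℝ) (p : SpaceTime d) : ℝ :=
  deriv (fun t => f (p.1, t)) p.2

/-- `u ∈ H¹(Q)`, with weak spatial gradient `gx` and weak time derivative `gt`. -/
structure IsH1 {d : ℕ} (Q : Set (SpaceTime d)) (u : SpaceTime d → ℝ)
    (gx : SpaceTime d → Space d) (gt : SpaceTime d → ℝ) : Prop where
  memLp : MemLp u 2 (volume.restrict Q)
  memLp_grad : MemLp gx 2 (volume.restrict Q)
  memLp_time : MemLp gt 2 (volume.restrict Q)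
  weak_grad : ∀ φ : SpaceTime d → ℝ, ContDiff ℝ ∞ φ → HasCompactSupport φ → tsupport φ ⊆ Q →
    ∫ p in Q, u p • spaceGrad φ p = -∫ p in Q, φ p • gx p
  weak_time : ∀ φ : SpaceTime d → ℝ, ContDiff ℝ ∞ φ → HasCompactSupport φ → tsupport φ ⊆ Q →
    ∫ p in Q, u p * timeDeriv φ p = -∫ p in Q, φ p * gt p

/-- The smooth functions `v n` on space-time, restricted to `Q`, converge in the norm of `H¹(Q)` to
the function `u` with weak derivatives `gx`, `gt`. -/
def TendstoH1 {d : ℕ} (Q : Set (SpaceTime d)) (v : ℕ → SpaceTime d → ℝ) (u : SpaceTime d → ℝ)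
    (gx : SpaceTime d → Space d) (gt : SpaceTime d → ℝ) : Prop :=
  Tendsto (fun n => eLpNorm (fun p => v n p - u p) 2 (volume.restrict Q)) atTop (𝓝 0) ∧
  Tendsto (fun n => eLpNorm (fun p => spaceGrad (v n) p - gx p) 2 (volume.restrict Q))
    atTop (𝓝 0) ∧
  Tendsto (fun n => eLpNorm (fun p => timeDeriv (v n) p - gt p) 2 (volume.restrict Q))
    atTop (𝓝 0)

/-- `w ∈ L²(Σ_τ)` is the trace on `Σ_τ` of `u ∈ H¹(Q_τ)`. As usual the trace is the continuous
extension to `H¹` of the restriction map: `w` is the `L²(Σ_τ)`-limit of the boundary values of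
functions that are smooth up to the boundary and converge to `u` in `H¹(Q_τ)`. -/
def IsLateralTrace {d : ℕ} (Ω : Set (Space d)) (τ : ℝ) (u : SpaceTime d → ℝ)
    (gx : SpaceTime d → Space d) (gt : SpaceTime d → ℝ) (w : SpaceTime d → ℝ) : Prop :=
  MemLp w 2 (lateralMeasure Ω τ) ∧
    ∃ v : ℕ → SpaceTime d → ℝ, (∀ n, ContDiff ℝ ∞ (v n)) ∧
      TendstoH1 (spaceTimeCylinder Ω τ) v u gx gt ∧
      Tendsto (fun n => eLpNorm (fun p => v n p - w p) 2 (lateralMeasure Ω τ)) atTop (𝓝 0)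

/-- `w ∈ L²(Ω)` is the trace `u(·, τ)` of `u ∈ H¹(Q_τ)` at the final time. -/
def IsFinalTrace {d : ℕ} (Ω : Set (Space d)) (τ : ℝ) (u : SpaceTime d → ℝ)
    (gx : SpaceTime d → Space d) (gt : SpaceTime d → ℝ) (w : Space d → ℝ) : Prop :=
  MemLp w 2 (volume.restrict Ω) ∧
    ∃ v : ℕ → SpaceTime d → ℝ, (∀ n, ContDiff ℝ ∞ (v n)) ∧
      TendstoH1 (spaceTimeCylinder Ω τ) v u gx gt ∧
      Tendsto (fun n => eLpNorm (fun x => v n (x, τ) - w x) 2 (volume.restrict Ω)) atTop (𝓝 0)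

/-- The transport operator `A u = ∂_t u + H(t) · ∇u` for given (classical or weak) derivatives
`gx = ∇u`, `gt = ∂_t u`. -/
def transport {d : ℕ} (H : ℝ → Space d) (gx : SpaceTime d → Space d) (gt : SpaceTime d → ℝ)
    (p : SpaceTime d) : ℝ :=
  gt p + ⟪H p.2, gx p⟫

/-- The weight `ψ(x, t) = |x - x₀|² - β t`. -/
def weight {d : ℕ} (x₀ : Space d) (β : ℝ) (p : SpaceTime d) : ℝ :=
  ‖p.1 - x₀‖ ^ 2 - β * p.2

/-- The function `A ψ`. -/
def transportWeight {d : ℕ} (H : ℝ → Space d) (x₀ : Space d) (β : ℝ) (p : SpaceTime d) : ℝ :=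
  transport H (spaceGrad (weight x₀ β)) (timeDeriv (weight x₀ β)) p

end CarlemanTransport

end

open CarlemanTransport

/-! Put a = Aψ = 2 H·(x − x₀) − β and w = e^{2sψ}. The angle condition on x − x₀, with |H| ≥ ρ and
|x − x₀| ≥ dist(x₀, Ω), gives a ≥ a₀ := 2δ − β > 0 on the closed cylinder.

Everything follows from integrating A(a w u²) over Q_τ. Since H depends on t alone, A has no
divergence term, so the integral equals the lateral integral of a w u² (H·ν), plus the contribution
at t = τ, minus that at t = 0. The last one is nonnegative because a > 0, and is dropped. On the
other hand A(a w u²) = w ((Aa) u² + 2s a² u² + 2 a u Au). After multiplication by s, the square (s a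
u + Au)² ≥ 0 leaves at least w (s² a² u² − |Au|² + s (Aa) u²), and for large s the last term is
absorbed by half of s² a₀² u². This is `carleman_estimate_of_contDiff`.

Two things have to be supplied around this computation. The first is the divergence theorem for the
Hausdorff surface measure (`IsSmoothBoundedDomain.divergence`): near the boundary Ω is a subgraph,
where a shear reduces the volume integral to a half-space, and the area formula identifies the
surface measure with the parameter measure of density |e − ∇γ|; a partition of unity glues the
pieces. The second is the passage to H¹: the two traces may be witnessed by different smooth
sequences, and a trace inequality at t = τ (`integral_final_sq_le`) lets a single sequence serve for
both. -/

namespace CarlemanTransport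

/-! ### The area formula for Euclidean Hausdorff measure. -/

section AreaFormula

open Module

/-- Countably many of the neighbourhoods cover the space; making them disjoint cuts any measurable
set into countably many pieces on which the comparison is available. -/
theorem measure_le_of_locally_le {X : Type*} [TopologicalSpace X] [SecondCountableTopology X]
    [MeasurableSpace X] [OpensMeasurableSpace X] {μ ν : Measure X}
    (h : ∀ x, ∃ U ∈ 𝓝 x, ∀ B ⊆ U, MeasurableSet B → μ B ≤ ν B) : μ ≤ ν := by
  choose U hU hB using h
  obtain ⟨s, hs, hsU⟩ := TopologicalSpace.countable_cover_nhds (fun x => interior_mem_nhds.2 (hU x))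
  refine Measure.le_iff.2 fun B hBm => ?_
  rcases s.eq_empty_or_nonempty with rfl | hne
  · have : B = ∅ := by
      have : (univ : Set X) = ∅ := by simpa using hsU.symm
      exact subset_empty_iff.1 (this ▸ subset_univ B)
    simp [this]
  obtain ⟨f, rfl⟩ := hs.exists_eq_range hne
  set W : ℕ → Set X := disjointed fun n => interior (U (f n)) with hW
  have hWm : ∀ n, MeasurableSet (W n) := fun n =>
    MeasurableSet.disjointed (fun n => isOpen_interior.measurableSet) n
  have hWu : ⋃ n, W n = univ := by
    rw [hW, iUnion_disjointed, ← hsU, biUnion_range]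
  have key : ∀ μ : Measure X, μ B = ∑' n, μ (B ∩ W n) := fun μ => by
    rw [← measure_iUnion, ← inter_iUnion, hWu, inter_univ]
    · exact fun i j hij => ((disjoint_disjointed _) hij).mono inter_subset_right inter_subset_right
    · exact fun n => hBm.inter (hWm n)
  rw [key μ, key ν]
  refine ENNReal.tsum_le_tsum fun n => hB (f n) _ ?_ (hBm.inter (hWm n))
  exact inter_subset_right.trans ((disjointed_subset _ n).trans interior_subset)

/-- On `s` the map `f` factors through `g` by a `K`-Lipschitz map of the image of `g`. In the area
formula the two roles are played by an immersion and its derivative, in either order. -/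
theorem hausdorffMeasure_image_le_of_dist_le {X Y Z : Type*} [PseudoMetricSpace X] [MetricSpace Y]
    [MeasurableSpace Y] [BorelSpace Y] [MetricSpace Z] [MeasurableSpace Z] [BorelSpace Z]
    {f : X → Y} {g : X → Z} {s : Set X} {K : NNReal} {d : ℝ} (hd : 0 ≤ d)
    (h : ∀ a ∈ s, ∀ b ∈ s, dist (f a) (f b) ≤ K * dist (g a) (g b)) :
    μH[d] (f '' s) ≤ (K : ENNReal) ^ d * μH[d] (g '' s) := by
  rcases s.eq_empty_or_nonempty with rfl | ⟨x, hx⟩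
  · simp
  have : Nonempty X := ⟨x⟩
  set r : Z → X := Function.invFunOn g s
  have hr : ∀ a ∈ s, r (g a) ∈ s ∧ g (r (g a)) = g a := fun a ha =>
    ⟨Function.invFunOn_mem ⟨a, ha, rfl⟩, Function.invFunOn_eq ⟨a, ha, rfl⟩⟩
  have hlip : LipschitzOnWith K (f ∘ r) (g '' s) := by
    refine LipschitzOnWith.of_dist_le_mul ?_
    rintro _ ⟨a, ha, rfl⟩ _ ⟨b, hb, rfl⟩
    have := h _ (hr a ha).1 _ (hr b hb).1
    rwa [(hr a ha).2, (hr b hb).2] at this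
  have him : f '' s = (f ∘ r) '' (g '' s) := by
    rw [image_image]
    refine image_congr fun a ha => ?_
    -- `a` and `r (g a)` have the same image under `g`, so the hypothesis bounds the distance of
    -- their images under `f` by zero.
    have := h _ ha _ (hr a ha).1
    rw [(hr a ha).2, dist_self, mul_zero] at this
    exact dist_le_zero.1 this
  rw [him]
  exact hlip.hausdorffMeasure_image_le hd

theorem euclideanHausdorffMeasure_image_le_of_dist_le {X Y Z : Type*} [PseudoMetricSpace X]
    [MetricSpace Y] [MeasurableSpace Y] [BorelSpace Y] [MetricSpace Z] [MeasurableSpace Z]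
    [BorelSpace Z] {f : X → Y} {g : X → Z} {s : Set X} {K : NNReal} (n : ℕ)
    (h : ∀ a ∈ s, ∀ b ∈ s, dist (f a) (f b) ≤ K * dist (g a) (g b)) :
    μHE[n] (f '' s) ≤ (K : ENNReal) ^ n * μHE[n] (g '' s) := by
  simp_rw [Measure.euclideanHausdorffMeasure_def, Measure.smul_apply, Measure.nnreal_smul_coe_apply]
  rw [mul_left_comm]
  gcongr
  simpa using hausdorffMeasure_image_le_of_dist_le (n.cast_nonneg) h

/-- Near a point where its derivative `L` is injective, a strictly differentiable map distorts
distances as `L` does, up to a factor close to one. -/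
theorem exists_nhds_dist_comparison {U F : Type*} [NormedAddCommGroup U]
    [InnerProductSpace ℝ U] [FiniteDimensional ℝ U] [NormedAddCommGroup F] [InnerProductSpace ℝ F]
    {Φ : U → F} {L : U →L[ℝ] F} {x : U}
    (hΦ : HasStrictFDerivAt Φ L x) (hL : Function.Injective L) {ε : ℝ} (hε : 0 < ε) :
    ∃ s ∈ 𝓝 x, ∀ a ∈ s, ∀ b ∈ s,
      dist (Φ a) (Φ b) ≤ (1 + ε) * dist (L a) (L b) ∧
      dist (L a) (L b) ≤ (1 + ε) * dist (Φ a) (Φ b) := by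
  obtain ⟨K, hK, hanti⟩ := L.toLinearMap.exists_antilipschitzWith (LinearMap.ker_eq_bot.2 hL)
  -- This choice gives both η ≤ ε and (1 + ε)(1 − η) = 1, one for each of the two inequalities.
  set η : ℝ := ε / (1 + ε)
  have hη : 0 < η := by positivity
  have hK' : (0 : ℝ) < K := hK
  have hc : (0 : ℝ) < η / K := by positivity
  -- With linearization error (η / K)‖a − b‖, the lower bound ‖a − b‖ ≤ K‖L (a − b)‖ turns the error
  -- into a relative one, η‖L (a − b)‖.
  obtain ⟨s, hs, happ⟩ := hΦ.approximates_deriv_on_nhds (c := ⟨η / K, hc.le⟩) (Or.inr hc)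
  refine ⟨s, hs, fun a ha b hb => ?_⟩
  have h1 := happ a ha b hb
  have h2 : ‖a - b‖ ≤ K * ‖L (a - b)‖ := by
    simpa [dist_eq_norm, ← map_sub] using hanti.le_mul_dist a b
  have h3 : ‖Φ a - Φ b - L (a - b)‖ ≤ η * ‖L (a - b)‖ := by
    refine h1.trans ?_
    change η / K * ‖a - b‖ ≤ _
    calc η / K * ‖a - b‖ ≤ η / K * (K * ‖L (a - b)‖) := by gcongr
      _ = _ := by field_simp
  have hη1 : η ≤ ε := by
    rw [div_le_iff₀ (by positivity)]; nlinarith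
  simp only [dist_eq_norm, ← map_sub]
  have h4 : ‖Φ a - Φ b‖ ≤ ‖Φ a - Φ b - L (a - b)‖ + ‖L (a - b)‖ := by
    simpa using norm_add_le (Φ a - Φ b - L (a - b)) (L (a - b))
  have h5 : ‖L (a - b)‖ ≤ ‖Φ a - Φ b - L (a - b)‖ + ‖Φ a - Φ b‖ := by
    rw [norm_sub_rev (Φ a - Φ b)]
    simpa using norm_add_le (L (a - b) - (Φ a - Φ b)) (Φ a - Φ b)
  constructor
  · nlinarith [norm_nonneg (L (a - b))]
  · have h6 : (1 - η) * ‖L (a - b)‖ ≤ ‖Φ a - Φ b‖ := by linarith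
    have h7 : (1 + ε) * (1 - η) = 1 := by simp only [η]; field_simp; ring
    calc ‖L (a - b)‖ = (1 + ε) * ((1 - η) * ‖L (a - b)‖) := by rw [← mul_assoc, h7, one_mul]
      _ ≤ _ := by gcongr

theorem measure_le_of_forall_one_add_pow {X : Type*} [MeasurableSpace X] {μ ν : Measure X} (n : ℕ)
    (h : ∀ ε : NNReal, 0 < ε → μ ≤ ((1 + ε : NNReal) : ENNReal) ^ n • ν) : μ ≤ ν := by
  refine Measure.le_iff.2 fun B _ => ?_
  have h1 : Tendsto (fun ε : NNReal => ((1 + ε : NNReal) : ENNReal) ^ n * ν B) (𝓝[>] 0)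
      (𝓝 (((1 + 0 : NNReal) : ENNReal) ^ n * ν B)) := by
    refine Tendsto.mono_left ?_ nhdsWithin_le_nhds
    refine ENNReal.Tendsto.mul_const ?_ (Or.inl (by simp))
    exact ((ENNReal.continuous_pow n).comp
      (ENNReal.continuous_coe.comp (continuous_const.add continuous_id))).tendsto 0
  have h2 : μ B ≤ ((1 + 0 : NNReal) : ENNReal) ^ n * ν B := by
    refine ge_of_tendsto h1 ?_
    filter_upwards [self_mem_nhdsWithin] with ε hε
    simpa using (h ε hε) B
  simpa using h2

/-- The area formula for an injective `C¹` immersion. -/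
theorem comap_euclideanHausdorffMeasure {U F : Type*} [NormedAddCommGroup U]
    [InnerProductSpace ℝ U] [FiniteDimensional ℝ U] [MeasurableSpace U] [BorelSpace U]
    [NormedAddCommGroup F] [InnerProductSpace ℝ F] [CompleteSpace F] [MeasurableSpace F]
    [BorelSpace F] {Φ : U → F} {L : U → U →L[ℝ] F}
    {J : U → ℝ} (hinj : Function.Injective Φ) (hΦ : ∀ x, HasStrictFDerivAt Φ (L x) x)
    (hJ : Continuous J) (hJpos : ∀ x, 0 < J x) (hLJ : ∀ x, (L x).toLinearMap.normDet = J x) :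
    Measure.comap Φ (μHE[finrank ℝ U] : Measure F) =
      volume.withDensity fun x => ENNReal.ofReal (J x) := by
  have : ProperSpace U := FiniteDimensional.proper ℝ U
  have hcont : Continuous Φ := continuous_iff_continuousAt.2 fun x => (hΦ x).continuousAt
  have hemb : MeasurableEmbedding Φ := hcont.measurableEmbedding hinj
  set n := finrank ℝ U
  have hLinj : ∀ x, Function.Injective (L x) := fun x =>
    ((L x).toLinearMap.normDet_ne_zero_tfae.out 0 4).1 (by rw [hLJ]; exact (hJpos x).ne')
  have hlin : ∀ x B, μHE[n] (L x '' B) = ENNReal.ofReal (J x) * volume B := fun x B => by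
    rw [← hLJ]
    exact (L x).toLinearMap.euclideanHausdorffMeasure_image_eq_normDet_mul_volume B
  -- Near `x`, up to the factor 1 + ε, the map can be replaced by its derivative at `x` and the
  -- density by its value at `x`; for the linear map the formula is already known.
  have hnear : ∀ x (ε : NNReal), 0 < ε → ∃ s ∈ 𝓝 x, (∀ a ∈ s, ∀ b ∈ s,
      dist (Φ a) (Φ b) ≤ (1 + ε : NNReal) * dist (L x a) (L x b) ∧
      dist (L x a) (L x b) ≤ (1 + ε : NNReal) * dist (Φ a) (Φ b)) ∧
      ∀ y ∈ s, J x ≤ (1 + ε) * J y ∧ J y ≤ (1 + ε) * J x := by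
    intro x ε hε
    obtain ⟨s, hs, h⟩ := exists_nhds_dist_comparison (hΦ x) (hLinj x) (ε := ε) hε
    have hε' : (0 : ℝ) < ε := hε
    have h1 : ∀ᶠ y in 𝓝 x, J x < (1 + ε) * J y :=
      (tendsto_const_nhds (x := J x)).eventually_lt ((hJ.tendsto x).const_mul _)
        (by nlinarith [hJpos x])
    have h2 : ∀ᶠ y in 𝓝 x, J y < (1 + ε) * J x :=
      (hJ.tendsto x).eventually_lt tendsto_const_nhds (by nlinarith [hJpos x])
    refine ⟨s ∩ {y | J x < (1 + ε) * J y ∧ J y < (1 + ε) * J x}, inter_mem hs (h1.and h2),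
      fun a ha b hb => ?_, fun y hy => ⟨hy.2.1.le, hy.2.2.le⟩⟩
    push_cast
    exact h a ha.1 b hb.1
  apply le_antisymm
  -- Of the n + 1 factors, n come from the distortion of n-dimensional measure and one from the
  -- oscillation of `J`.
  · refine measure_le_of_forall_one_add_pow (n + 1) fun ε hε => measure_le_of_locally_le fun x => ?_
    obtain ⟨s, hs, hd, hJs⟩ := hnear x ε hε
    refine ⟨s, hs, fun B hB hBm => ?_⟩
    rw [hemb.comap_apply, Measure.smul_apply, withDensity_apply _ hBm, smul_eq_mul, pow_succ,
      mul_assoc]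
    refine (euclideanHausdorffMeasure_image_le_of_dist_le n (g := L x)
      fun a ha b hb => (hd a (hB ha) b (hB hb)).1).trans ?_
    rw [hlin]
    refine mul_le_mul_right ?_ _
    rw [← lintegral_const_mul' _ _ (by simp), ← setLIntegral_const]
    refine setLIntegral_mono' hBm fun y hy => ?_
    rw [← ENNReal.ofReal_coe_nnreal, ← ENNReal.ofReal_mul (by positivity)]
    exact ENNReal.ofReal_le_ofReal (by push_cast; exact (hJs y (hB hy)).1)
  · refine measure_le_of_forall_one_add_pow (1 + n) fun ε hε => measure_le_of_locally_le fun x => ?_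
    obtain ⟨s, hs, hd, hJs⟩ := hnear x ε hε
    refine ⟨s, hs, fun B hB hBm => ?_⟩
    rw [Measure.smul_apply, hemb.comap_apply, withDensity_apply _ hBm, smul_eq_mul, pow_add,
      mul_assoc, pow_one]
    refine le_trans ?_ (mul_le_mul_right (euclideanHausdorffMeasure_image_le_of_dist_le n
      (f := L x) (g := Φ) fun a ha b hb => (hd a (hB ha) b (hB hb)).2) _)
    rw [hlin, ← mul_assoc, ← ENNReal.ofReal_coe_nnreal, ← ENNReal.ofReal_mul (by positivity),
      ← setLIntegral_const]
    refine setLIntegral_mono' hBm fun y hy => ?_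
    exact ENNReal.ofReal_le_ofReal (by push_cast; exact (hJs y (hB hy)).2)

/-- In an orthonormal basis of `V` the Gram matrix of `L` is the identity plus the rank-one matrix
of `a`, so the matrix determinant lemma gives 1 + ‖a‖². -/
theorem normDet_graph {E : Type*} [NormedAddCommGroup E] [InnerProductSpace ℝ E]
    (V : Submodule ℝ E) [FiniteDimensional ℝ V] (a : V) {e : E} (he : ‖e‖ = 1)
    (hV : ∀ y ∈ V, ⟪y, e⟫ = 0) (L : V →ₗ[ℝ] E) (hL : ∀ y : V, L y = (y : E) + ⟪a, y⟫ • e) :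
    L.normDet = Real.sqrt (1 + ‖a‖ ^ 2) := by
  rw [← Real.sqrt_sq L.normDet_nonneg]
  congr 1
  have h := L.normDet_sq_eq_det_gram (stdOrthonormalBasis ℝ V)
  set b := stdOrthonormalBasis ℝ V
  have hg : Matrix.gram ℝ (fun i => L (b i)) = 1 +
      Matrix.replicateCol Unit (fun i => ⟪a, b i⟫) * Matrix.replicateRow Unit (fun i => ⟪a, b i⟫) := by
    ext i j
    have h1 : ⟪(b i : E), (b j : E)⟫ = (1 : Matrix _ _ ℝ) i j := by
      rw [← Submodule.coe_inner, Matrix.one_apply]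
      exact orthonormal_iff_ite.1 b.orthonormal i j
    have h2 : ∀ i, ⟪e, (b i : E)⟫ = 0 := fun i => by rw [real_inner_comm]; exact hV _ (b i).2
    have h3 : ∀ i, ⟪(b i : E), e⟫ = 0 := fun i => hV _ (b i).2
    have h4 : ⟪e, e⟫ = 1 := by rw [real_inner_self_eq_norm_sq, he]; norm_num
    simp only [Matrix.gram_apply, hL, inner_add_left, inner_add_right, inner_smul_left,
      inner_smul_right, h1, h2, h3, h4, Matrix.add_apply, Matrix.mul_apply]
    simp [mul_comm]
  rw [hg, Matrix.det_one_add_replicateCol_mul_replicateRow] at h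
  simp only [RCLike.ofReal_real_eq_id, id] at h
  rw [h, ← real_inner_self_eq_norm_sq, ← b.sum_inner_mul_inner a a]
  simp [dotProduct, real_inner_comm]

end AreaFormula

/-! ### Graph coordinates and the divergence theorem below a graph. -/

section GraphChart

open Module

variable {E : Type*} [NormedAddCommGroup E] [InnerProductSpace ℝ E]

/-- Graph coordinates: `(y, r) ↦ y + (r + γ y) e`. -/
def graphChart (e : E) (γ : E → ℝ) (p : ((ℝ ∙ e)ᗮ : Submodule ℝ E) × ℝ) : E :=
  (p.1 : E) + (p.2 + γ p.1) • e

variable {e : E} {γ : E → ℝ}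

theorem inner_self_of_norm_eq_one (he : ‖e‖ = 1) : ⟪e, e⟫ = (1 : ℝ) := by
  rw [real_inner_self_eq_norm_sq, he]; norm_num

theorem inner_coe_orthogonal_singleton (y : ((ℝ ∙ e)ᗮ : Submodule ℝ E)) : ⟪(y : E), e⟫ = (0 : ℝ) := by
  rw [real_inner_comm]; exact Submodule.mem_orthogonal_singleton_iff_inner_right.1 y.2

theorem inner_graphChart (he : ‖e‖ = 1) (p) :
    ⟪graphChart e γ p, e⟫ = p.2 + γ p.1 := by
  simp [graphChart, inner_add_left, inner_smul_left, inner_coe_orthogonal_singleton, he]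

theorem apply_graphChart (hinv : ∀ (x : E) (r : ℝ), γ (x + r • e) = γ x) (p) :
    γ (graphChart e γ p) = γ p.1 := hinv _ _

theorem fderiv_apply_self_eq_zero (hinv : ∀ (x : E) (r : ℝ), γ (x + r • e) = γ x)
    (hγ : Differentiable ℝ γ) (x : E) : fderiv ℝ γ x e = 0 := by
  rw [← (hγ x).lineDeriv_eq_fderiv, lineDeriv]
  simp [hinv]

theorem fderiv_add_smul (hinv : ∀ (x : E) (r : ℝ), γ (x + r • e) = γ x) (x : E) (r : ℝ) :
    fderiv ℝ γ (x + r • e) = fderiv ℝ γ x := by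
  rw [← fderiv_comp_add_right]
  simp [hinv]

/-- Graph coordinates as a homeomorphism. -/
noncomputable def graphChartHomeomorph (he : ‖e‖ = 1) (hγ : Continuous γ)
    (hinv : ∀ (x : E) (r : ℝ), γ (x + r • e) = γ x) :
    (((ℝ ∙ e)ᗮ : Submodule ℝ E) × ℝ) ≃ₜ E where
  toFun := graphChart e γ
  invFun x := ((ℝ ∙ e)ᗮ.orthogonalProjectionOnto x, ⟪x, e⟫ - γ x)
  left_inv p := by
    have h1 : (ℝ ∙ e)ᗮ.orthogonalProjectionOnto e = 0 :=
      Submodule.orthogonalProjectionOnto_apply_of_mem_orthogonal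
        (Submodule.le_orthogonal_orthogonal _ (Submodule.mem_span_singleton_self e))
    refine Prod.ext ?_ ?_
    · simp [graphChart, h1]
    · simp [inner_graphChart he, apply_graphChart hinv]
  right_inv x := by
    have h2 : x = ⟪x, e⟫ • e + ((ℝ ∙ e)ᗮ.orthogonalProjectionOnto x : E) := by
      have := Submodule.starProjection_add_starProjection_orthogonal (K := ℝ ∙ e) x
      rw [Submodule.starProjection_unit_singleton ℝ he, real_inner_comm] at this
      exact this.symm
    have h3 : γ ((ℝ ∙ e)ᗮ.orthogonalProjectionOnto x) = γ x := by
      conv_rhs => rw [h2, add_comm, hinv]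
    simp only [graphChart, h3, sub_add_cancel]
    rw [add_comm]; exact h2.symm
  continuous_toFun := by unfold graphChart; fun_prop
  continuous_invFun := by fun_prop

theorem coe_graphChartHomeomorph (he : ‖e‖ = 1) (hγ : Continuous γ)
    (hinv : ∀ (x : E) (r : ℝ), γ (x + r • e) = γ x) :
    ⇑(graphChartHomeomorph he hγ hinv) = graphChart e γ := rfl

/-- Ensures that slices of compactly supported functions have compact support. -/
theorem isClosedEmbedding_prodMk_const {X Y : Type*} [TopologicalSpace X] [TopologicalSpace Y]
    [T1Space Y] (r : Y) : Topology.IsClosedEmbedding fun y : X => (y, r) := by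
  refine ⟨isEmbedding_prodMkLeft r, ?_⟩
  have : range (fun y : X => (y, r)) = Prod.snd ⁻¹' {r} := by ext ⟨a, b⟩; simp [eq_comm]
  rw [this]
  exact isClosed_singleton.preimage continuous_snd

theorem isClosedEmbedding_const_prodMk {X Y : Type*} [TopologicalSpace X] [TopologicalSpace Y]
    [T1Space X] (x : X) : Topology.IsClosedEmbedding fun r : Y => (x, r) := by
  refine ⟨isEmbedding_prodMkRight x, ?_⟩
  have : range (fun r : Y => (x, r)) = Prod.fst ⁻¹' {x} := by ext ⟨a, b⟩; simp [eq_comm]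
  rw [this]
  exact isClosed_singleton.preimage continuous_fst

theorem range_graphChart_zero (he : ‖e‖ = 1) (hγ : Continuous γ)
    (hinv : ∀ (x : E) (r : ℝ), γ (x + r • e) = γ x) :
    range (fun y => graphChart e γ (y, 0)) = {x | ⟪x, e⟫ = γ x} := by
  ext x
  constructor
  · rintro ⟨y, rfl⟩
    simp [inner_graphChart he, apply_graphChart hinv]
  · intro hx
    obtain ⟨p, rfl⟩ := (graphChartHomeomorph he hγ hinv).surjective x
    rw [coe_graphChartHomeomorph] at hx ⊢
    have : p.2 = 0 := by simpa [inner_graphChart he, apply_graphChart hinv] using hx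
    exact ⟨p.1, by rw [← this]⟩

theorem isClosedEmbedding_graphChart_zero (he : ‖e‖ = 1) (hγ : Continuous γ)
    (hinv : ∀ (x : E) (r : ℝ), γ (x + r • e) = γ x) :
    Topology.IsClosedEmbedding (fun y => graphChart e γ (y, 0)) :=
  (graphChartHomeomorph he hγ hinv).isClosedEmbedding.comp (isClosedEmbedding_prodMk_const 0)

/-- The chart is a shear in the second variable followed by the orthogonal splitting of `E` into the
line of `e` and its complement; both preserve volume. -/
theorem measurePreserving_graphChart [FiniteDimensional ℝ E] [MeasurableSpace E] [BorelSpace E] (he : ‖e‖ = 1)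
    (hγ : Continuous γ) : MeasurePreserving (graphChart e γ) := by
  have h1 : MeasurePreserving (fun p : ((ℝ ∙ e)ᗮ : Submodule ℝ E) × ℝ => (p.1, p.2 + γ p.1)) := by
    refine (MeasurePreserving.id volume).skew_product
      (g := fun (y : ((ℝ ∙ e)ᗮ : Submodule ℝ E)) (r : ℝ) => r + γ y) ?_ ?_
    · exact Continuous.measurable (by unfold Function.uncurry; fun_prop)
    · exact Eventually.of_forall fun y => map_add_right_eq_self _ _
  have h2 : MeasurePreserving (Prod.swap : ((ℝ ∙ e)ᗮ : Submodule ℝ E) × ℝ → _) :=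
    Measure.measurePreserving_swap
  have h3 : MeasurePreserving (Prod.map (LinearIsometryEquiv.toSpanUnitSingleton (𝕜 := ℝ) e he)
      (id : ((ℝ ∙ e)ᗮ : Submodule ℝ E) → _)) :=
    (LinearIsometryEquiv.measurePreserving _).prod (MeasurePreserving.id _)
  have h4 := ((ℝ ∙ e).measurePreserving_measurableEquivProd (0 : E)).symm
  rw [InnerProductSpace.euclideanHausdorffMeasure_eq_volume] at h4
  have := h4.comp (h3.comp (h2.comp h1))
  convert this using 1
  ext p
  simp [graphChart, add_comm]

theorem hasFDerivAt_graphChart (hγ : Differentiable ℝ γ) (p) :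
    HasFDerivAt (graphChart e γ)
      ((Submodule.subtypeL _).comp (.fst ℝ ((ℝ ∙ e)ᗮ : Submodule ℝ E) ℝ) +
        (ContinuousLinearMap.snd ℝ _ ℝ + (fderiv ℝ γ p.1).comp
          ((Submodule.subtypeL _).comp (.fst ℝ ((ℝ ∙ e)ᗮ : Submodule ℝ E) ℝ))).smulRight e) p := by
  have h1 : HasFDerivAt (fun p : ((ℝ ∙ e)ᗮ : Submodule ℝ E) × ℝ => (p.1 : E))
      ((Submodule.subtypeL _).comp (.fst ℝ ((ℝ ∙ e)ᗮ : Submodule ℝ E) ℝ)) p :=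
    ((Submodule.subtypeL (ℝ ∙ e)ᗮ).comp (.fst ℝ ((ℝ ∙ e)ᗮ : Submodule ℝ E) ℝ)).hasFDerivAt
  have h2 := (hγ (p.1 : E)).hasFDerivAt.comp p h1
  exact h1.add ((hasFDerivAt_snd.add h2).smul_const e)

variable [FiniteDimensional ℝ E]

/-- The upward normal `e - ∇γ` of a graph. -/
noncomputable def graphNormal (e : E) (γ : E → ℝ) (x : E) : E := e - gradient γ x

/-- The unit upward normal of a graph. -/
noncomputable def graphUnitNormal (e : E) (γ : E → ℝ) (x : E) : E :=
  ‖graphNormal e γ x‖⁻¹ • graphNormal e γ x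

/-- The graph normal is the gradient of the defining function x ↦ ⟪x, e⟫ − γ x. -/
theorem inner_graphNormal (h x : E) :
    ⟪h, graphNormal e γ x⟫ = ⟪h, e⟫ - fderiv ℝ γ x h := by
  rw [graphNormal, inner_sub_right, real_inner_comm (gradient γ x) h, gradient,
    InnerProductSpace.toDual_symm_apply]

/-- Since γ is constant along `e`, its derivative in that direction is zero. In particular the
normal never vanishes. -/
theorem inner_graphNormal_self (he : ‖e‖ = 1) (hinv : ∀ (x : E) (r : ℝ), γ (x + r • e) = γ x)
    (hγ : Differentiable ℝ γ) (x : E) : ⟪e, graphNormal e γ x⟫ = 1 := by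
  rw [inner_graphNormal, fderiv_apply_self_eq_zero hinv hγ, inner_self_of_norm_eq_one he, sub_zero]

theorem graphNormal_ne_zero (he : ‖e‖ = 1) (hinv : ∀ (x : E) (r : ℝ), γ (x + r • e) = γ x)
    (hγ : Differentiable ℝ γ) (x : E) : graphNormal e γ x ≠ 0 := fun h => by
  simpa [h] using inner_graphNormal_self he hinv hγ x

theorem norm_graphUnitNormal (he : ‖e‖ = 1) (hinv : ∀ (x : E) (r : ℝ), γ (x + r • e) = γ x)
    (hγ : Differentiable ℝ γ) (x : E) : ‖graphUnitNormal e γ x‖ = 1 := by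
  rw [graphUnitNormal, norm_smul, norm_inv, norm_norm,
    inv_mul_cancel₀ (norm_ne_zero_iff.2 (graphNormal_ne_zero he hinv hγ x))]

theorem continuous_graphNormal (hγ : ContDiff ℝ 1 γ) : Continuous (graphNormal e γ) := by
  have := hγ.continuous_fderiv one_ne_zero
  unfold graphNormal gradient
  fun_prop

theorem continuous_graphUnitNormal (he : ‖e‖ = 1)
    (hinv : ∀ (x : E) (r : ℝ), γ (x + r • e) = γ x) (hγ : ContDiff ℝ 1 γ) :
    Continuous (graphUnitNormal e γ) :=
  ((continuous_graphNormal hγ).norm.inv₀ fun x => norm_ne_zero_iff.2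
    (graphNormal_ne_zero he hinv (hγ.differentiable one_ne_zero) x)).smul (continuous_graphNormal hγ)

theorem integrable_fderiv_apply {X : Type*} [NormedAddCommGroup X] [NormedSpace ℝ X]
    [MeasurableSpace X] [OpensMeasurableSpace X] [SecondCountableTopology X] {μ : Measure X}
    [IsFiniteMeasureOnCompacts μ] {G : X → ℝ} (hG : ContDiff ℝ 1 G) (hGc : HasCompactSupport G)
    (v : X) {m : X → ℝ} (hm : Continuous m) : Integrable (fun p => m p * fderiv ℝ G p v) μ := by
  have h1 : HasCompactSupport fun p => fderiv ℝ G p v :=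
    (hGc.fderiv (𝕜 := ℝ)).comp_left (g := fun L : X →L[ℝ] ℝ => L v) rfl
  exact (hm.mul ((hG.continuous_fderiv one_ne_zero).clm_apply
    continuous_const)).integrable_of_hasCompactSupport h1.mul_left

section HalfSpace

variable {V : Type*} [NormedAddCommGroup V] [InnerProductSpace ℝ V] [FiniteDimensional ℝ V]
  [MeasurableSpace V] [BorelSpace V] {G : V × ℝ → ℝ}

theorem volume_restrict_univ_prod_Iio (a : ℝ) :
    (volume : Measure (V × ℝ)).restrict (univ ×ˢ Iio a) =
      (volume : Measure V).prod (volume.restrict (Iio a)) := by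
  rw [Measure.volume_eq_prod, ← Measure.prod_restrict, Measure.restrict_univ]

theorem integral_fderiv_eq_zero {G : V → ℝ} (hG : ContDiff ℝ 1 G) (hGc : HasCompactSupport G)
    (k : V) : ∫ y, fderiv ℝ G y k = 0 := by
  have h1 := integrable_fderiv_apply hG hGc k (continuous_const (y := (1 : ℝ))) (μ := volume)
  have := integral_mul_fderiv_eq_neg_fderiv_mul_of_integrable (μ := volume) (v := k)
    (f := fun _ : V => (1 : ℝ)) (g := G) (by simp) h1
    (by simpa using hG.continuous.integrable_of_hasCompactSupport hGc)
    (fun _ _ => differentiableAt_const _) (fun y _ => hG.differentiable one_ne_zero y)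
  simpa using this

/-- The direction is tangent to the boundary: on each slice r = const the integral over all of `V`
is that of a derivative of a compactly supported function. -/
theorem integral_prod_Iio_fderiv_left_eq_zero (hG : ContDiff ℝ 1 G) (hGc : HasCompactSupport G)
    (k : V) : ∫ p in univ ×ˢ Iio 0, fderiv ℝ G p (k, 0) = 0 := by
  have hi := (integrable_fderiv_apply hG hGc (k, 0) (continuous_const (y := (1 : ℝ)))
    (μ := volume)).integrableOn (s := univ ×ˢ Iio 0)
  simp only [one_mul] at hi
  rw [IntegrableOn, volume_restrict_univ_prod_Iio] at hi
  rw [volume_restrict_univ_prod_Iio, integral_prod_symm _ hi]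
  refine integral_eq_zero_of_ae (Eventually.of_forall fun r => ?_)
  have hd : ∀ y, fderiv ℝ (fun y : V => G (y, r)) y k = fderiv ℝ G (y, r) (k, 0) := fun y => by
    have h1 := (hG.differentiable one_ne_zero (y, r)).hasFDerivAt
    have := HasFDerivAt.comp (f := fun y : V => (y, r)) y h1
      ((hasFDerivAt_id y).prodMk (hasFDerivAt_const r y))
    simp only [Function.comp_def] at this
    rw [this.fderiv]
    simp
  simp only [← hd]
  exact integral_fderiv_eq_zero (hG.comp (contDiff_id.prodMk contDiff_const))
    (hGc.comp_isClosedEmbedding (isClosedEmbedding_prodMk_const r)) k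

/-- The weight is constant along each half-line, where the fundamental theorem of calculus leaves
only the boundary value at r = 0. -/
theorem integral_prod_Iio_mul_fderiv_right (hG : ContDiff ℝ 1 G) (hGc : HasCompactSupport G)
    {m : V → ℝ} (hm : Continuous m) :
    ∫ p in univ ×ˢ Iio 0, m p.1 * fderiv ℝ G p (0, 1) = ∫ y, m y * G (y, 0) := by
  have hi := (integrable_fderiv_apply hG hGc (0, 1) (hm.comp continuous_fst)
    (μ := volume)).integrableOn (s := univ ×ˢ Iio 0)
  rw [IntegrableOn, volume_restrict_univ_prod_Iio] at hi
  simp only [Function.comp_def] at hi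
  rw [volume_restrict_univ_prod_Iio, integral_prod _ hi]
  refine integral_congr_ae (Eventually.of_forall fun y => ?_)
  simp only
  rw [integral_const_mul, ← integral_Iic_eq_integral_Iio]
  congr 1
  have hGy : ContDiff ℝ 1 fun r : ℝ => G (y, r) := hG.comp (contDiff_const.prodMk contDiff_id)
  have hGyc : HasCompactSupport fun r : ℝ => G (y, r) :=
    hGc.comp_isClosedEmbedding (isClosedEmbedding_const_prodMk y)
  rw [← hGyc.integral_Iic_deriv_eq hGy 0]
  refine integral_congr_ae (Eventually.of_forall fun r => ?_)
  have h1 := (hG.differentiable one_ne_zero (y, r)).hasFDerivAt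
  have := HasFDerivAt.comp (f := fun r : ℝ => (y, r)) r h1
    ((hasFDerivAt_const y r).prodMk (hasFDerivAt_id r))
  simp only [Function.comp_def] at this
  simp [this.hasDerivAt.deriv]

end HalfSpace

/-- The divergence theorem below a graph, with the boundary integral in graph coordinates. -/
theorem setIntegral_fderiv_subgraph [MeasurableSpace E] [BorelSpace E] (he : ‖e‖ = 1)
    (hγ : ContDiff ℝ 1 γ) (hinv : ∀ (x : E) (r : ℝ), γ (x + r • e) = γ x) {g : E → ℝ}
    (hg : ContDiff ℝ 1 g) (hgc : HasCompactSupport g) (h : E) :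
    ∫ x in {x | ⟪x, e⟫ < γ x}, fderiv ℝ g x h =
      ∫ y : ((ℝ ∙ e)ᗮ : Submodule ℝ E),
        ⟪h, graphNormal e γ (graphChart e γ (y, 0))⟫ * g (graphChart e γ (y, 0)) := by
  have hγd := hγ.differentiable one_ne_zero
  set T := graphChartHomeomorph he hγ.continuous hinv
  have hTm := measurePreserving_graphChart he hγ.continuous
  set k : ((ℝ ∙ e)ᗮ : Submodule ℝ E) := (ℝ ∙ e)ᗮ.orthogonalProjectionOnto h
  have hk : h = (k : E) + ⟪h, e⟫ • e := by
    have := Submodule.starProjection_add_starProjection_orthogonal (K := ℝ ∙ e) h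
    rw [Submodule.starProjection_unit_singleton ℝ he, real_inner_comm] at this
    rw [add_comm]; exact this.symm
  set G : ((ℝ ∙ e)ᗮ : Submodule ℝ E) × ℝ → ℝ := g ∘ graphChart e γ
  have hchart : ContDiff ℝ 1 (graphChart e γ) := by
    have h1 : ContDiff ℝ 1 (fun p : ((ℝ ∙ e)ᗮ : Submodule ℝ E) × ℝ => (p.1 : E)) :=
      ((Submodule.subtypeL (ℝ ∙ e)ᗮ).comp (.fst ℝ ((ℝ ∙ e)ᗮ : Submodule ℝ E) ℝ)).contDiff
    exact h1.add ((contDiff_snd.add (hγ.comp h1)).smul contDiff_const)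
  have hG : ContDiff ℝ 1 G := hg.comp hchart
  have hGc : HasCompactSupport G := hgc.comp_isClosedEmbedding T.isClosedEmbedding
  set m : ((ℝ ∙ e)ᗮ : Submodule ℝ E) → ℝ := fun y => ⟪h, e⟫ - fderiv ℝ γ y h
  have hm : Continuous m := by
    have := hγ.continuous_fderiv one_ne_zero
    fun_prop
  have hnormal : ∀ y : ((ℝ ∙ e)ᗮ : Submodule ℝ E),
      ⟪h, graphNormal e γ (graphChart e γ (y, 0))⟫ = m y := fun y => by
    rw [inner_graphNormal, graphChart, fderiv_add_smul hinv]
  have hmk : ∀ y : ((ℝ ∙ e)ᗮ : Submodule ℝ E), m y = ⟪h, e⟫ - fderiv ℝ γ y k := fun y => by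
    have : fderiv ℝ γ y h = fderiv ℝ γ y k := by
      conv_lhs => rw [hk]
      simp [fderiv_apply_self_eq_zero hinv hγd]
    simp only [m, this]
  -- The derivative of the chart sends (k, r) to k + (r + dγ(k)) e. Since h = k + ⟪h, e⟫ e, the
  -- direction `h` pulls back to (k, m), with `m` the pairing of `h` with the graph normal.
  have hcomp : ∀ p, fderiv ℝ g (graphChart e γ p) h =
      fderiv ℝ G p (k, 0) + m p.1 * fderiv ℝ G p (0, 1) := fun p => by
    have h1 := (hg.differentiable one_ne_zero _).hasFDerivAt.comp p (hasFDerivAt_graphChart hγd p)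
    rw [← smul_eq_mul, ← map_smul, ← map_add, h1.fderiv, ContinuousLinearMap.comp_apply]
    congr 1
    conv_lhs => rw [hk]
    simp [hmk]
  have hint1 := integrable_fderiv_apply hG hGc (k, 0) (continuous_const (y := (1 : ℝ)))
    (μ := volume)
  have hint2 := integrable_fderiv_apply hG hGc (0, 1) (hm.comp continuous_fst) (μ := volume)
  simp only [one_mul] at hint1
  simp only [Function.comp_def] at hint2
  have hpre : graphChart e γ ⁻¹' {x | ⟪x, e⟫ < γ x} = univ ×ˢ Iio 0 := by
    ext p
    simp [inner_graphChart he, apply_graphChart hinv]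
  have hzero := integral_prod_Iio_fderiv_left_eq_zero hG hGc k
  have hone := integral_prod_Iio_mul_fderiv_right hG hGc hm
  rw [← hTm.setIntegral_preimage_emb T.measurableEmbedding, hpre]
  simp_rw [hcomp]
  rw [integral_add hint1.integrableOn hint2.integrableOn, hzero, hone, zero_add]
  simp_rw [hnormal]
  rfl

/-- The surface measure of a graph in graph coordinates. -/
theorem euclideanHausdorffMeasure_restrict_graph [MeasurableSpace E] [BorelSpace E] (he : ‖e‖ = 1)
    (hγ : ContDiff ℝ 1 γ) (hinv : ∀ (x : E) (r : ℝ), γ (x + r • e) = γ x) :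
    (μHE[finrank ℝ E - 1] : Measure E).restrict {x | ⟪x, e⟫ = γ x} =
      Measure.map (fun y => graphChart e γ (y, 0)) (volume.withDensity fun y =>
        ENNReal.ofReal ‖graphNormal e γ (graphChart e γ (y, 0))‖) := by
  have hγd := hγ.differentiable one_ne_zero
  have hemb := isClosedEmbedding_graphChart_zero he hγ.continuous hinv
  have hrank : finrank ℝ E - 1 = finrank ℝ ((ℝ ∙ e)ᗮ : Submodule ℝ E) := by
    have h1 := (ℝ ∙ e).finrank_add_finrank_orthogonal
    rw [finrank_span_singleton (by rintro rfl; simp at he)] at h1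
    omega
  rw [hrank, ← comap_euclideanHausdorffMeasure hemb.injective
    (J := fun y => ‖graphNormal e γ (graphChart e γ (y, 0))‖)
    (L := fun y : ((ℝ ∙ e)ᗮ : Submodule ℝ E) => (Submodule.subtypeL _) +
      ((fderiv ℝ γ y).comp (Submodule.subtypeL _)).smulRight e),
    hemb.measurableEmbedding.map_comap, range_graphChart_zero he hγ.continuous hinv]
  · intro y
    have h1 : HasStrictFDerivAt (fun y : ((ℝ ∙ e)ᗮ : Submodule ℝ E) => (y : E))
        (Submodule.subtypeL _) y :=
      (Submodule.subtypeL (ℝ ∙ e)ᗮ).hasStrictFDerivAt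
    have h2 := (hγ.contDiffAt.hasStrictFDerivAt (x := (y : E)) one_ne_zero).comp y h1
    have h3 := h1.add (h2.smul_const e)
    simp only [graphChart, zero_add]
    exact h3
  · exact ((continuous_graphNormal hγ).comp hemb.continuous).norm
  · exact fun y => norm_pos_iff.2 (graphNormal_ne_zero he hinv hγd _)
  · intro y
    -- As ∇γ is orthogonal to `e`, ‖e − ∇γ‖² = 1 + ‖∇γ‖², so the length of the graph normal is the
    -- Jacobian of the parametrization.
    set v := gradient γ (y : E)
    have hv : ∀ h, ⟪v, h⟫ = fderiv ℝ γ y h := fun h => InnerProductSpace.toDual_symm_apply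
    have hve : ⟪v, e⟫ = 0 := by rw [hv, fderiv_apply_self_eq_zero hinv hγd]
    have hvmem : v ∈ (ℝ ∙ e)ᗮ :=
      Submodule.mem_orthogonal_singleton_iff_inner_right.2 (by rw [real_inner_comm]; exact hve)
    rw [normDet_graph (ℝ ∙ e)ᗮ ⟨v, hvmem⟩ he (fun z hz => inner_coe_orthogonal_singleton ⟨z, hz⟩)]
    · have h1 : graphNormal e γ (graphChart e γ (y, 0)) = e - v := by
        rw [graphNormal, gradient, graphChart, fderiv_add_smul hinv]; rfl
      rw [h1, Real.sqrt_eq_iff_mul_self_eq (by positivity) (norm_nonneg _),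
        norm_sub_mul_self_real, real_inner_comm, hve, he]
      simp
      ring
    · intro z
      simp [← hv]

theorem euclideanHausdorffMeasure_graph_inter_lt_top [MeasurableSpace E] [BorelSpace E]
    (he : ‖e‖ = 1) (hγ : ContDiff ℝ 1 γ) (hinv : ∀ (x : E) (r : ℝ), γ (x + r • e) = γ x)
    {K : Set E} (hK : IsCompact K) :
    (μHE[finrank ℝ E - 1] : Measure E) ({x | ⟪x, e⟫ = γ x} ∩ K) < ⊤ := by
  have hemb := isClosedEmbedding_graphChart_zero he hγ.continuous hinv
  rw [inter_comm, ← Measure.restrict_apply hK.measurableSet,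
    euclideanHausdorffMeasure_restrict_graph he hγ hinv,
    hemb.measurableEmbedding.map_apply,
    withDensity_apply _ (hemb.continuous.measurable hK.measurableSet)]
  have hc : Continuous fun y => ‖graphNormal e γ (graphChart e γ (y, 0))‖ :=
    ((continuous_graphNormal hγ).comp hemb.continuous).norm
  exact (hc.continuousOn.integrableOn_compact (hemb.isCompact_preimage hK)).lintegral_lt_top

/-- The divergence theorem below a graph. -/
theorem setIntegral_fderiv_subgraph_eq_surface [MeasurableSpace E] [BorelSpace E] (he : ‖e‖ = 1)
    (hγ : ContDiff ℝ 1 γ) (hinv : ∀ (x : E) (r : ℝ), γ (x + r • e) = γ x) {g : E → ℝ}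
    (hg : ContDiff ℝ 1 g) (hgc : HasCompactSupport g) (h : E) :
    ∫ x in {x | ⟪x, e⟫ < γ x}, fderiv ℝ g x h =
      ∫ x in {x | ⟪x, e⟫ = γ x}, g x * ⟪h, graphUnitNormal e γ x⟫ ∂μHE[finrank ℝ E - 1] := by
  have hemb := isClosedEmbedding_graphChart_zero he hγ.continuous hinv
  rw [setIntegral_fderiv_subgraph he hγ hinv hg hgc,
    euclideanHausdorffMeasure_restrict_graph he hγ hinv, hemb.measurableEmbedding.integral_map]
  rw [integral_withDensity_eq_integral_toReal_smul]
  · refine integral_congr_ae (Eventually.of_forall fun y => ?_)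
    -- The length of the normal enters once as surface density and once as normalization of the unit
    -- normal; the two cancel.
    have := norm_ne_zero_iff.2 (graphNormal_ne_zero he hinv (hγ.differentiable one_ne_zero)
      (graphChart e γ (y, 0)))
    simp only [graphUnitNormal, inner_smul_right, ENNReal.toReal_ofReal (norm_nonneg _), smul_eq_mul]
    field_simp
  · exact (((continuous_graphNormal hγ).comp hemb.continuous).norm.measurable).ennreal_ofReal
  · exact Eventually.of_forall fun _ => ENNReal.ofReal_lt_top

end GraphChart

/-! ### The outer normal and the divergence theorem on a smooth bounded domain. -/

section SmoothDomain

variable {d : ℕ} {Ω : Set (Space d)}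

/-- `Ω ∩ U` is the part of `U` below the graph of `γ` in the direction `e`. -/
structure IsBoundaryChart (Ω U : Set (Space d)) (e : Space d) (γ : Space d → ℝ) : Prop where
  isOpen : IsOpen U
  norm_eq : ‖e‖ = 1
  contDiff : ContDiff ℝ ∞ γ
  invariant : ∀ (x : Space d) (r : ℝ), γ (x + r • e) = γ x
  inter_eq : Ω ∩ U = {x | x ∈ U ∧ ⟪x, e⟫ < γ x}

/-- If n ≠ n', the direction n' − n is obtuse to `n` and acute to `n'`, so the same short segment
would lie in Ω and outside its closure. -/
theorem IsOuterUnitNormal.unique {p n n' : Space d} (h : IsOuterUnitNormal Ω p n)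
    (h' : IsOuterUnitNormal Ω p n') : n = n' := by
  by_contra hne
  have hlt : ⟪n, n'⟫ < (1 : ℝ) := (inner_lt_one_iff_real_of_norm_eq_one h.1 h'.1).2 hne
  have h1 : ⟪n' - n, n⟫ < (0 : ℝ) := by
    rw [inner_sub_left, inner_self_of_norm_eq_one h.1, real_inner_comm]; linarith
  have h2 : (0 : ℝ) < ⟪n' - n, n'⟫ := by
    rw [inner_sub_left, inner_self_of_norm_eq_one h'.1]; linarith
  obtain ⟨r, hr, hr'⟩ := ((h.2.1 _ h1).and (h'.2.2 _ h2)).exists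
  exact hr' (subset_closure hr)

theorem IsOuterUnitNormal.outerNormal_eq {p n : Space d} (h : IsOuterUnitNormal Ω p n) :
    outerNormal Ω p = n := by
  have hex : ∃ n, IsOuterUnitNormal Ω p n := ⟨n, h⟩
  rw [outerNormal, dif_pos hex]
  exact hex.choose_spec.unique h

namespace IsBoundaryChart

variable {U : Set (Space d)} {e : Space d} {γ : Space d → ℝ}

theorem contDiff_one (hc : IsBoundaryChart Ω U e γ) : ContDiff ℝ 1 γ :=
  hc.contDiff.of_le (by exact_mod_cast le_top)

theorem mem_iff (hc : IsBoundaryChart Ω U e γ) {x : Space d} (hx : x ∈ U) :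
    x ∈ Ω ↔ ⟪x, e⟫ < γ x := by
  have := congrArg (x ∈ ·) hc.inter_eq
  simpa [hx] using this

theorem notMem_closure (hc : IsBoundaryChart Ω U e γ) {x : Space d} (hx : x ∈ U)
    (h : γ x < ⟪x, e⟫) : x ∉ closure Ω := by
  have hop : IsOpen (U ∩ {x | γ x < ⟪x, e⟫}) :=
    hc.isOpen.inter (isOpen_lt hc.contDiff.continuous (by fun_prop))
  rw [mem_closure_iff]
  push Not
  refine ⟨_, hop, ⟨hx, h⟩, ?_⟩
  ext y
  simp only [mem_inter_iff, mem_ofPred_eq, mem_empty_iff_false, iff_false]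
  rintro ⟨⟨hyU, hy⟩, hyΩ⟩
  exact lt_asymm hy ((hc.mem_iff hyU).1 hyΩ)

/-- The defining function ⟪·, e⟫ − γ vanishes at `p` and has derivative ⟪v, graphNormal⟫ along `v`;
its sign decides on which side of the graph p + r v lies for small r > 0. -/
theorem isOuterUnitNormal (hc : IsBoundaryChart Ω U e γ) {p : Space d} (hp : p ∈ U)
    (hpe : ⟪p, e⟫ = γ p) : IsOuterUnitNormal Ω p (graphUnitNormal e γ p) := by
  have hγd := hc.contDiff_one.differentiable one_ne_zero
  have hN := graphNormal_ne_zero hc.norm_eq hc.invariant hγd p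
  have hNpos : 0 < ‖graphNormal e γ p‖⁻¹ := inv_pos.2 (norm_pos_iff.2 hN)
  have hder : ∀ v : Space d, HasDerivAt (fun r : ℝ => ⟪p + r • v, e⟫ - γ (p + r • v))
      ⟪v, graphNormal e γ p⟫ 0 := fun v => by
    have h0 : HasDerivAt (fun r : ℝ => p + r • v) v 0 := by
      simpa using ((hasDerivAt_id (0 : ℝ)).smul_const v).const_add p
    have h1 : HasDerivAt (fun r : ℝ => ⟪p + r • v, e⟫) ⟪v, e⟫ 0 := by
      simpa using h0.inner ℝ (hasDerivAt_const (0 : ℝ) e)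
    have h2 : HasDerivAt (fun r : ℝ => γ (p + r • v)) (fderiv ℝ γ p v) 0 := by
      have := (hγd (p + (0 : ℝ) • v)).hasFDerivAt.comp_hasDerivAt 0 h0
      simp only [zero_smul, add_zero] at this
      exact this
    rw [inner_graphNormal]
    exact h1.sub h2
  have hU : ∀ v : Space d, ∀ᶠ r : ℝ in 𝓝[>] 0, p + r • v ∈ U := fun v => by
    have hcont : Continuous fun r : ℝ => p + r • v := by fun_prop
    have : Tendsto (fun r : ℝ => p + r • v) (𝓝 0) (𝓝 p) := by simpa using hcont.tendsto 0
    exact (this.mono_left nhdsWithin_le_nhds) (hc.isOpen.mem_nhds hp)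
  have h0 : ⟪p + (0 : ℝ) • (0 : Space d), e⟫ - γ (p + (0 : ℝ) • (0 : Space d)) = 0 := by simp [hpe]
  refine ⟨norm_graphUnitNormal hc.norm_eq hc.invariant hγd p, fun v hv => ?_, fun v hv => ?_⟩
  · rw [graphUnitNormal, inner_smul_right] at hv
    have hv' : ⟪v, graphNormal e γ p⟫ < (0 : ℝ) := by nlinarith
    have hs := (hasDerivAt_iff_tendsto_slope.1 (hder v)).eventually (gt_mem_nhds hv')
    have hs' : ∀ᶠ r : ℝ in 𝓝[>] 0, _ :=
      hs.filter_mono (nhdsWithin_mono _ fun r (hr : 0 < r) => hr.ne')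
    filter_upwards [hs', hU v, self_mem_nhdsWithin] with r hr hrU hr0
    rw [hc.mem_iff hrU]
    simp only [slope_def_field, zero_smul, add_zero, hpe, sub_self, sub_zero] at hr
    have hr0 : 0 < r := hr0
    rw [div_lt_iff₀ hr0] at hr
    linarith
  · rw [graphUnitNormal, inner_smul_right] at hv
    have hv' : (0 : ℝ) < ⟪v, graphNormal e γ p⟫ := pos_of_mul_pos_right hv hNpos.le
    have hs := (hasDerivAt_iff_tendsto_slope.1 (hder v)).eventually (lt_mem_nhds hv')
    have hs' : ∀ᶠ r : ℝ in 𝓝[>] 0, _ :=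
      hs.filter_mono (nhdsWithin_mono _ fun r (hr : 0 < r) => hr.ne')
    filter_upwards [hs', hU v, self_mem_nhdsWithin] with r hr hrU hr0
    refine hc.notMem_closure hrU ?_
    simp only [slope_def_field, zero_smul, add_zero, hpe, sub_self, sub_zero] at hr
    have hr0 : 0 < r := hr0
    rw [lt_div_iff₀ hr0] at hr
    linarith

/-- Points below the graph lie in Ω and points above lie outside its closure, while a point on the
graph is a limit of points of Ω along the inward normal. -/
theorem mem_frontier_iff (hc : IsBoundaryChart Ω U e γ) (hΩ : IsOpen Ω) {x : Space d} (hx : x ∈ U) :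
    x ∈ frontier Ω ↔ ⟪x, e⟫ = γ x := by
  rw [hΩ.frontier_eq]
  refine ⟨fun h => ?_, fun h => ⟨?_, fun hxΩ => ((hc.mem_iff hx).1 hxΩ).ne h⟩⟩
  · rcases lt_trichotomy ⟪x, e⟫ (γ x) with h1 | h1 | h1
    · exact absurd ((hc.mem_iff hx).2 h1) h.2
    · exact h1
    · exact absurd h.1 (hc.notMem_closure hx h1)
  · have hn := hc.isOuterUnitNormal hx h
    have hneg : ⟪-graphUnitNormal e γ x, graphUnitNormal e γ x⟫ < (0 : ℝ) := by
      rw [inner_neg_left, inner_self_of_norm_eq_one hn.1]; norm_num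
    have hcont : Continuous fun r : ℝ => x + r • (-graphUnitNormal e γ x) := by fun_prop
    have ht : Tendsto (fun r : ℝ => x + r • (-graphUnitNormal e γ x)) (𝓝[>] 0) (𝓝 x) := by
      have := hcont.tendsto 0
      simp only [zero_smul, add_zero] at this
      exact this.mono_left nhdsWithin_le_nhds
    exact mem_closure_of_tendsto ht (hn.2.1 _ hneg)

theorem outerNormal_eq (hc : IsBoundaryChart Ω U e γ) (hΩ : IsOpen Ω) {x : Space d} (hx : x ∈ U)
    (hxf : x ∈ frontier Ω) : outerNormal Ω x = graphUnitNormal e γ x :=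
  (hc.isOuterUnitNormal hx ((hc.mem_frontier_iff hΩ hx).1 hxf)).outerNormal_eq

end IsBoundaryChart

namespace IsSmoothBoundedDomain

theorem exists_chart (hΩ : IsSmoothBoundedDomain Ω) {p : Space d} (hp : p ∈ frontier Ω) :
    ∃ U e γ, p ∈ U ∧ IsBoundaryChart Ω U e γ := by
  obtain ⟨U, hU, hpU, e, γ, he, hγ, hinv, h⟩ := hΩ.smoothBoundary p hp
  exact ⟨U, e, γ, hpU, hU, he, hγ, hinv, h⟩

theorem continuousOn_outerNormal (hΩ : IsSmoothBoundedDomain Ω) :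
    ContinuousOn (outerNormal Ω) (frontier Ω) := by
  intro p hp
  obtain ⟨U, e, γ, hpU, hc⟩ := hΩ.exists_chart hp
  refine ((continuous_graphUnitNormal hc.norm_eq hc.invariant
    hc.contDiff_one).continuousWithinAt).congr_of_eventuallyEq ?_
    (hc.outerNormal_eq hΩ.isOpen hpU hp)
  filter_upwards [self_mem_nhdsWithin, mem_nhdsWithin_of_mem_nhds (hc.isOpen.mem_nhds hpU)]
    with x hx hxU using hc.outerNormal_eq hΩ.isOpen hxU hx

theorem isCompact_closure (hΩ : IsSmoothBoundedDomain Ω) : IsCompact (closure Ω) :=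
  hΩ.isBounded.isCompact_closure

theorem isCompact_frontier (hΩ : IsSmoothBoundedDomain Ω) : IsCompact (frontier Ω) :=
  hΩ.isCompact_closure.of_isClosed_subset isClosed_frontier frontier_subset_closure

theorem isFiniteMeasure_surfaceMeasure (hΩ : IsSmoothBoundedDomain Ω) :
    IsFiniteMeasure (surfaceMeasure Ω) := by
  refine ⟨?_⟩
  rw [surfaceMeasure, Measure.restrict_apply_univ]
  refine hΩ.isCompact_frontier.measure_lt_top_of_nhdsWithin fun p hp => ?_
  obtain ⟨U, e, γ, hpU, hc⟩ := hΩ.exists_chart hp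
  refine ⟨frontier Ω ∩ (U ∩ Metric.closedBall p 1), inter_mem self_mem_nhdsWithin
    (mem_nhdsWithin_of_mem_nhds (inter_mem (hc.isOpen.mem_nhds hpU)
      (Metric.closedBall_mem_nhds p one_pos))), ?_⟩
  have := euclideanHausdorffMeasure_graph_inter_lt_top hc.norm_eq hc.contDiff_one hc.invariant
    (isCompact_closedBall p 1)
  rw [finrank_euclideanSpace_fin] at this
  refine (measure_mono ?_).trans_lt this
  exact fun x hx => ⟨(hc.mem_frontier_iff hΩ.isOpen hx.2.1).1 hx.1, hx.2.2⟩

theorem integrable_surfaceMeasure (hΩ : IsSmoothBoundedDomain Ω) {f : Space d → ℝ}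
    (hf : ContinuousOn f (frontier Ω)) : Integrable f (surfaceMeasure Ω) := by
  have := hΩ.isFiniteMeasure_surfaceMeasure
  obtain ⟨C, hC⟩ := hΩ.isCompact_frontier.exists_bound_of_continuousOn hf
  refine Integrable.of_bound (hf.aestronglyMeasurable isClosed_frontier.measurableSet) C ?_
  exact (ae_restrict_mem isClosed_frontier.measurableSet).mono hC

/-- Both sides vanish: the left is a whole-space integral of a derivative, and φ is zero on the
boundary. -/
theorem divergence_of_tsupport_subset (hΩ : IsSmoothBoundedDomain Ω) {φ : Space d → ℝ}
    (hφ : ContDiff ℝ 1 φ) (hsupp : tsupport φ ⊆ Ω) (h : Space d) :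
    ∫ x in Ω, fderiv ℝ φ x h = ∫ x, φ x * ⟪h, outerNormal Ω x⟫ ∂surfaceMeasure Ω := by
  have hφc : HasCompactSupport φ := hΩ.isCompact_closure.of_isClosed_subset (isClosed_tsupport _)
    (hsupp.trans subset_closure)
  rw [setIntegral_eq_integral_of_forall_compl_eq_zero, integral_fderiv_eq_zero hφ hφc, eq_comm]
  · refine integral_eq_zero_of_ae ?_
    filter_upwards [ae_restrict_mem isClosed_frontier.measurableSet] with x hx
    rw [hΩ.isOpen.frontier_eq] at hx
    simp [image_eq_zero_of_notMem_tsupport fun hx' => hx.2 (hsupp hx')]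
  · intro x hx
    have : x ∉ tsupport (fderiv ℝ φ) := fun hx' => hx (hsupp (tsupport_fderiv_subset ℝ hx'))
    simp [image_eq_zero_of_notMem_tsupport this]

/-- As φ vanishes off `U`, Ω may be exchanged for the full subgraph and its frontier for the full
graph. -/
theorem divergence_of_tsupport_subset_chart (hΩ : IsSmoothBoundedDomain Ω) {U : Set (Space d)}
    {e : Space d} {γ : Space d → ℝ} (hc : IsBoundaryChart Ω U e γ) {φ : Space d → ℝ}
    (hφ : ContDiff ℝ 1 φ) (hφc : HasCompactSupport φ) (hsupp : tsupport φ ⊆ U) (h : Space d) :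
    ∫ x in Ω, fderiv ℝ φ x h = ∫ x, φ x * ⟪h, outerNormal Ω x⟫ ∂surfaceMeasure Ω := by
  have hz : ∀ x ∉ U, fderiv ℝ φ x h = 0 := fun x hx => by
    have : x ∉ tsupport (fderiv ℝ φ) := fun hx' => hx (hsupp (tsupport_fderiv_subset ℝ hx'))
    simp [image_eq_zero_of_notMem_tsupport this]
  have hz' : ∀ x ∉ U, φ x = 0 := fun x hx =>
    image_eq_zero_of_notMem_tsupport fun hx' => hx (hsupp hx')
  have hsub : MeasurableSet {x : Space d | ⟪x, e⟫ < γ x} :=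
    (isOpen_lt (by fun_prop) hc.contDiff.continuous).measurableSet
  have hgr : MeasurableSet {x : Space d | ⟪x, e⟫ = γ x} :=
    (isClosed_eq (by fun_prop) hc.contDiff.continuous).measurableSet
  have key := setIntegral_fderiv_subgraph_eq_surface hc.norm_eq hc.contDiff_one hc.invariant
    hφ hφc h
  rw [finrank_euclideanSpace_fin] at key
  have e1 : ∫ x in Ω, fderiv ℝ φ x h = ∫ x in Ω ∩ U, fderiv ℝ φ x h :=
    setIntegral_eq_of_subset_of_forall_sdiff_eq_zero hΩ.isOpen.measurableSet inter_subset_left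
      fun x hx => hz x fun hxU => hx.2 ⟨hx.1, hxU⟩
  have e2 : ∫ x in {x | ⟪x, e⟫ < γ x}, fderiv ℝ φ x h = ∫ x in Ω ∩ U, fderiv ℝ φ x h :=
    setIntegral_eq_of_subset_of_forall_sdiff_eq_zero hsub
      (fun x hx => (hc.mem_iff hx.2).1 hx.1)
      fun x hx => hz x fun hxU => hx.2 ⟨(hc.mem_iff hxU).2 hx.1, hxU⟩
  rw [e1, ← e2, key, surfaceMeasure]
  have e3 : ∫ x in {x | ⟪x, e⟫ = γ x}, φ x * ⟪h, graphUnitNormal e γ x⟫ ∂μHE[d - 1] =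
      ∫ x in frontier Ω ∩ U, φ x * ⟪h, graphUnitNormal e γ x⟫ ∂μHE[d - 1] :=
    setIntegral_eq_of_subset_of_forall_sdiff_eq_zero hgr
      (fun x hx => (hc.mem_frontier_iff hΩ.isOpen hx.2).1 hx.1) fun x hx => by
        rw [hz' x fun hxU => hx.2 ⟨(hc.mem_frontier_iff hΩ.isOpen hxU).2 hx.1, hxU⟩, zero_mul]
  have e4 : ∫ x in frontier Ω, φ x * ⟪h, outerNormal Ω x⟫ ∂μHE[d - 1] =
      ∫ x in frontier Ω ∩ U, φ x * ⟪h, outerNormal Ω x⟫ ∂μHE[d - 1] :=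
    setIntegral_eq_of_subset_of_forall_sdiff_eq_zero isClosed_frontier.measurableSet
      inter_subset_left fun x hx => by rw [hz' x fun hxU => hx.2 ⟨hx.1, hxU⟩, zero_mul]
  rw [e3, e4]
  refine setIntegral_congr_fun (isClosed_frontier.measurableSet.inter hc.isOpen.measurableSet)
    fun x hx => ?_
  simp only [hc.outerNormal_eq hΩ.isOpen hx.2 hx.1]

/-- The divergence theorem on a smooth bounded domain, for the vector field `g • h`. -/
theorem divergence (hΩ : IsSmoothBoundedDomain Ω) {g : Space d → ℝ} (hg : ContDiff ℝ 1 g)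
    (h : Space d) :
    ∫ x in Ω, fderiv ℝ g x h = ∫ x, g x * ⟪h, outerNormal Ω x⟫ ∂surfaceMeasure Ω := by
  classical
  choose! U e γ hpU hc using fun p (hp : p ∈ frontier Ω) => hΩ.exists_chart hp
  obtain ⟨t, ht, htU⟩ := hΩ.isCompact_frontier.elim_nhds_subcover
    (fun p => U p ∩ Metric.ball p 1)
    fun p hp => inter_mem ((hc p hp).isOpen.mem_nhds (hpU p hp)) (Metric.ball_mem_nhds p one_pos)
  -- The index `none` stands for the interior piece. Intersecting the charts with balls makes the
  -- boundary pieces compactly supported.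
  set W : Option t → Set (Space d) :=
    fun i => i.elim Ω fun p => U p ∩ Metric.ball (p : Space d) 1
  have hWo : ∀ i, IsOpen (W i) := by
    rintro (_ | p)
    · exact hΩ.isOpen
    · exact (hc p (ht p p.2)).isOpen.inter Metric.isOpen_ball
  have hWc : closure Ω ⊆ ⋃ i, W i := by
    intro x hx
    by_cases hxΩ : x ∈ Ω
    · exact mem_iUnion.2 ⟨none, hxΩ⟩
    · have hxf : x ∈ frontier Ω := by rw [hΩ.isOpen.frontier_eq]; exact ⟨hx, hxΩ⟩
      obtain ⟨p, hp, hxp⟩ := mem_iUnion₂.1 (htU hxf)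
      exact mem_iUnion.2 ⟨some ⟨p, hp⟩, hxp⟩
  obtain ⟨f, hf⟩ := SmoothPartitionOfUnity.exists_isSubordinate (modelWithCornersSelf ℝ (Space d))
    isClosed_closure W hWo hWc
  set φ : Option t → Space d → ℝ := fun i x => f i x * g x
  have hfd : ∀ i, ContDiff ℝ 1 (f i) := fun i =>
    (f i).contMDiff.contDiff.of_le (by exact_mod_cast le_top)
  have hφ : ∀ i, ContDiff ℝ 1 (φ i) := fun i => (hfd i).mul hg
  have hφs : ∀ i, tsupport (φ i) ⊆ W i := fun i => (tsupport_mul_subset_left).trans (hf i)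
  have hsum : ∀ x ∈ closure Ω, ∑ i, φ i x = g x := fun x hx => by
    have := f.sum_eq_one hx
    rw [finsum_eq_sum_of_fintype] at this
    rw [← Finset.sum_mul, this, one_mul]
  have hloc : ∀ i, ∫ x in Ω, fderiv ℝ (φ i) x h =
      ∫ x, φ i x * ⟪h, outerNormal Ω x⟫ ∂surfaceMeasure Ω := by
    rintro (_ | p)
    · exact hΩ.divergence_of_tsupport_subset (hφ _) (hφs none) h
    · have hs : tsupport (φ (some p)) ⊆ U p ∩ Metric.ball (p : Space d) 1 := hφs (some p)
      refine hΩ.divergence_of_tsupport_subset_chart (hc p (ht p p.2)) (hφ _) ?_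
        (hs.trans inter_subset_left) h
      exact (isCompact_closedBall (p : Space d) 1).of_isClosed_subset (isClosed_tsupport _)
        (hs.trans (inter_subset_right.trans Metric.ball_subset_closedBall))
  have hleft : ∫ x in Ω, fderiv ℝ g x h = ∑ i, ∫ x in Ω, fderiv ℝ (φ i) x h := by
    rw [← integral_finsetSum]
    · refine setIntegral_congr_fun hΩ.isOpen.measurableSet fun x hx => ?_
      -- The pieces sum to `g` only on the closure of Ω; openness of Ω is what allows
      -- differentiating this identity.
      have : g =ᶠ[𝓝 x] fun x => ∑ i, φ i x := by
        filter_upwards [hΩ.isOpen.mem_nhds hx] with y hy using (hsum y (subset_closure hy)).symm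
      rw [this.fderiv_eq, fderiv_fun_sum fun i _ => (hφ i).differentiable one_ne_zero x]
      simp
    · intro i _
      have : Continuous fun x => fderiv ℝ (φ i) x h :=
        ((hφ i).continuous_fderiv one_ne_zero).clm_apply continuous_const
      exact (this.continuousOn.integrableOn_compact hΩ.isCompact_closure).mono_set subset_closure
  rw [hleft, Finset.sum_congr rfl fun i _ => hloc i, ← integral_finsetSum]
  · refine integral_congr_ae ?_
    filter_upwards [ae_restrict_mem isClosed_frontier.measurableSet] with x hx
    rw [← Finset.sum_mul, hsum x (frontier_subset_closure hx)]
  · exact fun i _ => hΩ.integrable_surfaceMeasure (((hφ i).continuous.continuousOn).mul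
      (continuousOn_const.inner hΩ.continuousOn_outerNormal))

end IsSmoothBoundedDomain

end SmoothDomain

/-! ### Integration by parts for the transport operator and the estimate for smooth functions. -/

section SmoothEstimate

variable {d : ℕ} {Ω : Set (Space d)} {τ : ℝ}

/-- A `C¹` curve on a compact interval extends to a `C¹` curve on the line. -/
theorem exists_contDiff_extension {F : Type*} [NormedAddCommGroup F] [NormedSpace ℝ F]
    [CompleteSpace F] (hτ : 0 < τ) {H : ℝ → F} (hH : ContDiffOn ℝ 1 H (Icc 0 τ)) :
    ∃ K : ℝ → F, ContDiff ℝ 1 K ∧ EqOn K H (Icc 0 τ) := by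
  set D : ℝ → F := derivWithin H (Icc 0 τ)
  have hD : ContinuousOn D (Icc 0 τ) :=
    hH.continuousOn_derivWithin (uniqueDiffOn_Icc hτ) le_rfl
  -- The derivative is extended by its endpoint values and then integrated from 0.
  set D' : ℝ → F := IccExtend hτ.le ((Icc 0 τ).domRestrict D)
  have hD' : Continuous D' := (continuousOn_iff_continuous_domRestrict.1 hD).Icc_extend'
  have hDD' : ∀ t ∈ Icc 0 τ, D' t = D t := fun t ht => by
    simp [D', IccExtend_of_mem _ _ ht]
  have hder : ∀ t, HasDerivAt (fun t => H 0 + ∫ r in (0 : ℝ)..t, D' r) (D' t) t := fun t =>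
    (intervalIntegral.integral_hasDerivAt_right (hD'.intervalIntegrable _ _)
      (hD'.stronglyMeasurableAtFilter _ _) hD'.continuousAt).const_add _
  refine ⟨fun t => H 0 + ∫ r in (0 : ℝ)..t, D' r, ?_, fun t ht => ?_⟩
  · rw [contDiff_one_iff_deriv]
    refine ⟨fun t => (hder t).differentiableAt, ?_⟩
    rw [funext fun t => (hder t).deriv]
    exact hD'
  · have h1 : ∫ r in (0 : ℝ)..t, D' r = H t - H 0 := by
      refine intervalIntegral.integral_eq_sub_of_hasDerivAt_of_le ht.1
        (hH.continuousOn.mono (Icc_subset_Icc_right ht.2)) (fun r hr => ?_)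
        (hD'.intervalIntegrable _ _)
      have hr' : r ∈ Ioo 0 τ := ⟨hr.1, hr.2.trans_le ht.2⟩
      rw [hDD' r (Ioo_subset_Icc_self hr')]
      have hmem : Icc 0 τ ∈ 𝓝 r := Icc_mem_nhds hr'.1 hr'.2
      exact ((hH.differentiableOn one_ne_zero r
        (Ioo_subset_Icc_self hr')).hasDerivWithinAt).hasDerivAt hmem
    simp [h1]

theorem inner_spaceGrad {f : SpaceTime d → ℝ} {p : SpaceTime d} (hf : DifferentiableAt ℝ f p)
    (k : Space d) : ⟪k, spaceGrad f p⟫ = fderiv ℝ f p (k, 0) := by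
  have h1 : HasFDerivAt (fun x : Space d => f (x, p.2)) _ p.1 :=
    HasFDerivAt.comp (f := fun x : Space d => (x, p.2)) p.1 hf.hasFDerivAt
      ((hasFDerivAt_id p.1).prodMk (hasFDerivAt_const p.2 p.1))
  rw [spaceGrad, real_inner_comm, gradient, InnerProductSpace.toDual_symm_apply, h1.fderiv]
  simp

theorem fderiv_space_eq {f : SpaceTime d → ℝ} {p : SpaceTime d} (hf : DifferentiableAt ℝ f p)
    (k : Space d) : fderiv ℝ (fun x => f (x, p.2)) p.1 k = fderiv ℝ f p (k, 0) := by
  have h1 : HasFDerivAt (fun x : Space d => f (x, p.2)) _ p.1 :=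
    HasFDerivAt.comp (f := fun x : Space d => (x, p.2)) p.1 hf.hasFDerivAt
      ((hasFDerivAt_id p.1).prodMk (hasFDerivAt_const p.2 p.1))
  rw [h1.fderiv]
  simp

theorem hasDerivAt_time {f : SpaceTime d → ℝ} {p : SpaceTime d} (hf : DifferentiableAt ℝ f p) :
    HasDerivAt (fun t => f (p.1, t)) (fderiv ℝ f p (0, 1)) p.2 := by
  have h1 := HasFDerivAt.comp (f := fun t : ℝ => (p.1, t)) p.2 hf.hasFDerivAt
      ((hasFDerivAt_const p.1 p.2).prodMk (hasFDerivAt_id p.2))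
  simpa [Function.comp_def] using h1.hasDerivAt

theorem timeDeriv_eq_fderiv {f : SpaceTime d → ℝ} {p : SpaceTime d}
    (hf : DifferentiableAt ℝ f p) : timeDeriv f p = fderiv ℝ f p (0, 1) :=
  (hasDerivAt_time hf).deriv

theorem transport_eq_fderiv (K : ℝ → Space d) {f : SpaceTime d → ℝ} {p : SpaceTime d}
    (hf : DifferentiableAt ℝ f p) :
    transport K (spaceGrad f) (timeDeriv f) p = fderiv ℝ f p (K p.2, 1) := by
  rw [transport, inner_spaceGrad hf, timeDeriv_eq_fderiv hf, ← map_add]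
  simp

theorem continuous_timeDeriv {f : SpaceTime d → ℝ} (hf : ContDiff ℝ 1 f) :
    Continuous (timeDeriv f) := by
  have h : timeDeriv f = fun p => fderiv ℝ f p (0, 1) :=
    funext fun p => timeDeriv_eq_fderiv (hf.differentiable one_ne_zero p)
  rw [h]
  exact (hf.continuous_fderiv one_ne_zero).clm_apply continuous_const

theorem norm_outerNormal_le (x : Space d) : ‖outerNormal Ω x‖ ≤ 1 := by
  unfold outerNormal
  split_ifs with h
  · exact h.choose_spec.1.le
  · simp

theorem volume_restrict_cylinder :
    (volume : Measure (SpaceTime d)).restrict (spaceTimeCylinder Ω τ) =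
      (volume.restrict Ω).prod (volume.restrict (Ioo 0 τ)) := by
  rw [spaceTimeCylinder, Measure.volume_eq_prod, Measure.prod_restrict]

namespace IsSmoothBoundedDomain

theorem isCompact_cylinder (hΩ : IsSmoothBoundedDomain Ω) :
    IsCompact (closure Ω ×ˢ Icc 0 τ : Set (SpaceTime d)) :=
  hΩ.isCompact_closure.prod isCompact_Icc

theorem cylinder_subset : (spaceTimeCylinder Ω τ) ⊆ closure Ω ×ˢ Icc 0 τ :=
  prod_mono subset_closure Ioo_subset_Icc_self

theorem measurableSet_cylinder (hΩ : IsSmoothBoundedDomain Ω) :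
    MeasurableSet (spaceTimeCylinder Ω τ) := hΩ.isOpen.measurableSet.prod measurableSet_Ioo

theorem isFiniteMeasure_lateralMeasure (hΩ : IsSmoothBoundedDomain Ω) :
    IsFiniteMeasure (lateralMeasure Ω τ) := by
  have := hΩ.isFiniteMeasure_surfaceMeasure
  unfold lateralMeasure
  infer_instance

theorem integrableOn_cylinder (hΩ : IsSmoothBoundedDomain Ω) {f : SpaceTime d → ℝ}
    (hf : Continuous f) : IntegrableOn f (spaceTimeCylinder Ω τ) :=
  (hf.continuousOn.integrableOn_compact hΩ.isCompact_cylinder).mono_set cylinder_subset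

theorem ae_lateralMeasure_mem (hΩ : IsSmoothBoundedDomain Ω) :
    ∀ᵐ p ∂lateralMeasure Ω τ, p.1 ∈ frontier Ω ∧ p.2 ∈ Ioo 0 τ := by
  have := hΩ.isFiniteMeasure_surfaceMeasure
  have h1 : ∀ᵐ x ∂surfaceMeasure Ω, x ∈ frontier Ω :=
    ae_restrict_mem isClosed_frontier.measurableSet
  have h2 : ∀ᵐ t ∂(volume.restrict (Ioo 0 τ)), t ∈ Ioo 0 τ := ae_restrict_mem measurableSet_Ioo
  exact (Measure.quasiMeasurePreserving_fst.ae h1).and (Measure.quasiMeasurePreserving_snd.ae h2)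

theorem aestronglyMeasurable_outerNormal (hΩ : IsSmoothBoundedDomain Ω) :
    AEStronglyMeasurable (fun p : SpaceTime d => outerNormal Ω p.1) (lateralMeasure Ω τ) := by
  have h1 : AEStronglyMeasurable (outerNormal Ω) (surfaceMeasure Ω) :=
    hΩ.continuousOn_outerNormal.aestronglyMeasurable isClosed_frontier.measurableSet
  exact h1.comp_fst

theorem exists_bound_lateral (hΩ : IsSmoothBoundedDomain Ω) {a : SpaceTime d → ℝ}
    (ha : Continuous a) {K : ℝ → Space d} (hK : Continuous K) :
    ∃ C, ∀ᵐ p ∂lateralMeasure Ω τ, ‖a p * ⟪K p.2, outerNormal Ω p.1⟫‖ ≤ C := by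
  have hb : Continuous fun p : SpaceTime d => ‖a p‖ * ‖K p.2‖ := by fun_prop
  obtain ⟨C, hC⟩ := (hΩ.isCompact_cylinder (τ := τ)).exists_bound_of_continuousOn hb.continuousOn
  refine ⟨C, ?_⟩
  filter_upwards [hΩ.ae_lateralMeasure_mem] with p hp
  have h1 := hC p ⟨frontier_subset_closure hp.1, Ioo_subset_Icc_self hp.2⟩
  rw [Real.norm_of_nonneg (by positivity)] at h1
  refine le_trans ?_ h1
  rw [norm_mul]
  gcongr
  calc _ ≤ ‖K p.2‖ * ‖outerNormal Ω p.1‖ := norm_inner_le_norm _ _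
    _ ≤ ‖K p.2‖ * 1 := by gcongr; exact norm_outerNormal_le _
    _ = _ := mul_one _

theorem aestronglyMeasurable_lateral (hΩ : IsSmoothBoundedDomain Ω) {a : SpaceTime d → ℝ}
    (ha : Continuous a) {K : ℝ → Space d} (hK : Continuous K) :
    AEStronglyMeasurable (fun p => a p * ⟪K p.2, outerNormal Ω p.1⟫) (lateralMeasure Ω τ) :=
  ha.aestronglyMeasurable.mul
    ((hK.comp continuous_snd).aestronglyMeasurable.inner hΩ.aestronglyMeasurable_outerNormal)

theorem integrable_lateral (hΩ : IsSmoothBoundedDomain Ω) {a : SpaceTime d → ℝ}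
    (ha : Continuous a) {K : ℝ → Space d} (hK : Continuous K) :
    Integrable (fun p => a p * ⟪K p.2, outerNormal Ω p.1⟫) (lateralMeasure Ω τ) := by
  have := hΩ.isFiniteMeasure_lateralMeasure (τ := τ)
  obtain ⟨C, hC⟩ := hΩ.exists_bound_lateral (τ := τ) ha hK
  exact Integrable.of_bound (hΩ.aestronglyMeasurable_lateral ha hK) C hC

theorem integral_timeDeriv (hΩ : IsSmoothBoundedDomain Ω) (hτ : 0 < τ) {q : SpaceTime d → ℝ}
    (hq : ContDiff ℝ 1 q) :
    ∫ p in spaceTimeCylinder Ω τ, fderiv ℝ q p (0, 1) =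
      (∫ x in Ω, q (x, τ)) - ∫ x in Ω, q (x, 0) := by
  have hc : Continuous fun p => fderiv ℝ q p (0, 1) :=
    (hq.continuous_fderiv one_ne_zero).clm_apply continuous_const
  have hi := hΩ.integrableOn_cylinder (τ := τ) hc
  have hint : ∀ t : ℝ, IntegrableOn (fun x => q (x, t)) Ω := fun t =>
    ((hq.continuous.comp (by fun_prop : Continuous fun x : Space d =>
      (x, t))).continuousOn.integrableOn_compact hΩ.isCompact_closure).mono_set subset_closure
  rw [IntegrableOn, volume_restrict_cylinder] at hi
  rw [volume_restrict_cylinder, integral_prod _ hi, ← integral_sub (hint _) (hint _)]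
  refine integral_congr_ae (Eventually.of_forall fun x => ?_)
  simp only
  rw [← integral_Ioc_eq_integral_Ioo, ← intervalIntegral.integral_of_le hτ.le]
  exact intervalIntegral.integral_eq_sub_of_hasDerivAt (f := fun t => q (x, t))
    (f' := fun t => fderiv ℝ q (x, t) (0, 1)) (fun t _ => hasDerivAt_time (p := (x, t)) (hq.differentiable one_ne_zero _))
    ((hc.comp (by fun_prop : Continuous fun t : ℝ => (x, t))).intervalIntegrable _ _)

/-- At each fixed time the field `K t` is constant in space, so the divergence theorem on the slice
produces no interior term. -/
theorem integral_spaceDeriv (hΩ : IsSmoothBoundedDomain Ω) {K : ℝ → Space d}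
    (hK : Continuous K) {q : SpaceTime d → ℝ} (hq : ContDiff ℝ 1 q) :
    ∫ p in spaceTimeCylinder Ω τ, fderiv ℝ q p (K p.2, 0) =
      ∫ p, q p * ⟪K p.2, outerNormal Ω p.1⟫ ∂lateralMeasure Ω τ := by
  have := hΩ.isFiniteMeasure_surfaceMeasure
  have hc : Continuous fun p : SpaceTime d => fderiv ℝ q p (K p.2, 0) :=
    (hq.continuous_fderiv one_ne_zero).clm_apply (by fun_prop)
  have hi := hΩ.integrableOn_cylinder (τ := τ) hc
  have hi' := hΩ.integrable_lateral (τ := τ) hq.continuous hK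
  rw [IntegrableOn, volume_restrict_cylinder] at hi
  rw [lateralMeasure] at hi' ⊢
  rw [volume_restrict_cylinder, integral_prod_symm _ hi, integral_prod_symm _ hi']
  refine integral_congr_ae (Eventually.of_forall fun t => ?_)
  have hqt : ContDiff ℝ 1 fun x : Space d => q (x, t) := hq.comp (contDiff_id.prodMk contDiff_const)
  simp only
  rw [← hΩ.divergence hqt (K t)]
  refine integral_congr_ae (Eventually.of_forall fun x => ?_)
  exact (fderiv_space_eq (p := (x, t)) (hq.differentiable one_ne_zero _) (K t)).symm

/-- Integration by parts for the transport operator on the cylinder. -/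
theorem integral_transport (hΩ : IsSmoothBoundedDomain Ω) (hτ : 0 < τ) {K : ℝ → Space d}
    (hK : Continuous K) {q : SpaceTime d → ℝ} (hq : ContDiff ℝ 1 q) :
    ∫ p in spaceTimeCylinder Ω τ, fderiv ℝ q p (K p.2, 1) =
      (∫ p, q p * ⟪K p.2, outerNormal Ω p.1⟫ ∂lateralMeasure Ω τ) +
        ((∫ x in Ω, q (x, τ)) - ∫ x in Ω, q (x, 0)) := by
  rw [← hΩ.integral_timeDeriv hτ hq, ← hΩ.integral_spaceDeriv hK hq, ← integral_add]
  · refine integral_congr_ae (Eventually.of_forall fun p => ?_)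
    simp only [← map_add]
    simp
  · exact hΩ.integrableOn_cylinder
      ((hq.continuous_fderiv one_ne_zero).clm_apply (by fun_prop))
  · exact hΩ.integrableOn_cylinder
      ((hq.continuous_fderiv one_ne_zero).clm_apply continuous_const)

end IsSmoothBoundedDomain

theorem contDiff_weight (x₀ : Space d) (β : ℝ) {n : WithTop ℕ∞} : ContDiff ℝ n (weight x₀ β) :=
  ((contDiff_fst.sub contDiff_const).norm_sq ℝ).sub (contDiff_const.mul contDiff_snd)

theorem transportWeight_eq_fderiv (K : ℝ → Space d) (x₀ : Space d) (β : ℝ) (p : SpaceTime d) :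
    transportWeight K x₀ β p = fderiv ℝ (weight x₀ β) p (K p.2, 1) :=
  transport_eq_fderiv K ((contDiff_weight x₀ β).differentiable one_ne_zero p)

theorem transportWeight_eq (K : ℝ → Space d) (x₀ : Space d) (β : ℝ) (p : SpaceTime d) :
    transportWeight K x₀ β p = 2 * ⟪K p.2, p.1 - x₀⟫ - β := by
  have h1 : HasFDerivAt (fun p : SpaceTime d => p.1 - x₀) (.fst ℝ (Space d) ℝ) p :=
    hasFDerivAt_fst.sub_const x₀
  have h2 : HasFDerivAt (weight x₀ β) _ p := h1.norm_sq.sub (hasFDerivAt_snd.const_mul β)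
  rw [transportWeight_eq_fderiv, h2.fderiv]
  rw [real_inner_comm]
  simp [inner_sub_left]

/-- The regularity of the velocity in time is spent here: Aψ itself gets differentiated in the
estimate. -/
theorem contDiff_transportWeight {K : ℝ → Space d} (hK : ContDiff ℝ 1 K) (x₀ : Space d) (β : ℝ) :
    ContDiff ℝ 1 (transportWeight K x₀ β) := by
  rw [funext (transportWeight_eq K x₀ β)]
  exact (contDiff_const.mul ((hK.comp contDiff_snd).inner ℝ
    (contDiff_fst.sub contDiff_const))).sub contDiff_const

/-- The product rule, with Aψ appearing once more when the exponential is differentiated. The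
resulting term 2s (Aψ)² v² is the coercive one. -/
theorem fderiv_weighted_sq {K : ℝ → Space d} (hK : ContDiff ℝ 1 K) (x₀ : Space d) (β s : ℝ)
    {v : SpaceTime d → ℝ} (hv : ContDiff ℝ 1 v) (p : SpaceTime d) :
    fderiv ℝ (fun p => transportWeight K x₀ β p * Real.exp (2 * s * weight x₀ β p) * v p ^ 2) p
        (K p.2, 1) =
      Real.exp (2 * s * weight x₀ β p) *
        (fderiv ℝ (transportWeight K x₀ β) p (K p.2, 1) * v p ^ 2 +
          2 * s * transportWeight K x₀ β p ^ 2 * v p ^ 2 +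
          2 * transportWeight K x₀ β p * v p * transport K (spaceGrad v) (timeDeriv v) p) := by
  have h1 := ((contDiff_transportWeight hK x₀ β).differentiable one_ne_zero p).hasFDerivAt
  have h2 := ((contDiff_weight x₀ β (n := 1)).differentiable one_ne_zero p).hasFDerivAt
  have h3 := (hv.differentiable one_ne_zero p)
  rw [transport_eq_fderiv K h3]
  have h := (h1.mul (h2.const_mul (2 * s)).exp).mul (h3.hasFDerivAt.pow 2)
  have h' : HasFDerivAt (fun p => transportWeight K x₀ β p *
      Real.exp (2 * s * weight x₀ β p) * v p ^ 2) _ p := h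
  rw [h'.fderiv]
  simp only [add_apply, smul_apply,
    ← transportWeight_eq_fderiv K x₀ β p, smul_eq_mul]
  simp
  ring

/-- The Carleman estimate for functions that are smooth up to the boundary. -/
theorem carleman_estimate_of_contDiff (hΩ : IsSmoothBoundedDomain Ω) (hτ : 0 < τ)
    {K : ℝ → Space d} (hK : ContDiff ℝ 1 K) {x₀ : Space d} {β a₀ : ℝ} (ha₀ : 0 < a₀)
    (hpos : ∀ x ∈ closure Ω, ∀ t ∈ Icc 0 τ, a₀ ≤ transportWeight K x₀ β (x, t)) :
    ∃ sStar : ℝ, 0 < sStar ∧ ∃ C : ℝ, 0 < C ∧ ∃ C' : ℝ, 0 < C' ∧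
      ∀ s : ℝ, sStar < s → ∀ v : SpaceTime d → ℝ, ContDiff ℝ 1 v →
        s ^ 2 * ∫ p in spaceTimeCylinder Ω τ, Real.exp (2 * s * weight x₀ β p) * v p ^ 2 ≤
          C * (∫ p in spaceTimeCylinder Ω τ, Real.exp (2 * s * weight x₀ β p) *
              transport K (spaceGrad v) (timeDeriv v) p ^ 2) +
          C * s * (∫ p, Real.exp (2 * s * weight x₀ β p) * transportWeight K x₀ β p *
              ⟪K p.2, outerNormal Ω p.1⟫ * v p ^ 2 ∂(lateralMeasure Ω τ)) +
          C' * s * (∫ x in Ω, Real.exp (2 * s * weight x₀ β (x, τ)) * v (x, τ) ^ 2) := by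
  have ha := contDiff_transportWeight hK x₀ β
  set a := transportWeight K x₀ β
  have hψ := (contDiff_weight x₀ β (n := 1)).continuous
  have hDa : Continuous fun p : SpaceTime d => fderiv ℝ a p (K p.2, 1) :=
    (ha.continuous_fderiv one_ne_zero).clm_apply
      ((hK.continuous.comp continuous_snd).prodMk continuous_const)
  obtain ⟨M, hM⟩ := (hΩ.isCompact_cylinder (τ := τ)).exists_bound_of_continuousOn hDa.continuousOn
  obtain ⟨a₁, ha₁⟩ :=
    (hΩ.isCompact_cylinder (τ := τ)).exists_bound_of_continuousOn ha.continuous.continuousOn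
  -- A single point of the cylinder shows that the bounds `a₁` and `M` have the right sign.
  obtain ⟨x, hx⟩ := hΩ.isConnected.nonempty
  have hxτ : (x, τ) ∈ closure Ω ×ˢ Icc 0 τ := ⟨subset_closure hx, hτ.le, le_rfl⟩
  have ha₁pos : 0 < a₁ := ha₀.trans_le ((hpos x hxτ.1 τ hxτ.2).trans
    ((le_abs_self _).trans (ha₁ _ hxτ)))
  have hM0 : 0 ≤ M := (norm_nonneg _).trans (hM _ hxτ)
  -- Beyond 2M / a₀² the error s M v² is at most half of a₀² s² v²; the added 1 keeps the threshold
  -- positive when M = 0. The factor 2 / a₀² undoes the remaining coefficient a₀² / 2.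
  refine ⟨2 * M / a₀ ^ 2 + 1, by positivity, 2 / a₀ ^ 2, by positivity, 2 * a₁ / a₀ ^ 2,
    by positivity, fun s hs v hv => ?_⟩
  have hs0 : 0 < s := lt_trans (by positivity) hs
  have hsM : 2 * M ≤ a₀ ^ 2 * s := by
    have : 2 * M / a₀ ^ 2 ≤ s := by linarith
    rwa [div_le_iff₀ (by positivity), mul_comm s] at this
  set w : SpaceTime d → ℝ := fun p => Real.exp (2 * s * weight x₀ β p)
  have hwc : Continuous w := by fun_prop
  set q : SpaceTime d → ℝ := fun p => a p * w p * v p ^ 2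
  have hq : ContDiff ℝ 1 q :=
    (ha.mul ((contDiff_const.mul (contDiff_weight x₀ β)).exp)).mul (hv.pow 2)
  set Av := transport K (spaceGrad v) (timeDeriv v)
  have hAv : Continuous Av := by
    have h : Av = fun p => fderiv ℝ v p (K p.2, 1) :=
      funext fun p => transport_eq_fderiv K (hv.differentiable one_ne_zero p)
    rw [h]
    exact (hv.continuous_fderiv one_ne_zero).clm_apply
      ((hK.continuous.comp continuous_snd).prodMk continuous_const)
  have hDq : Continuous fun p : SpaceTime d => fderiv ℝ q p (K p.2, 1) :=
    (hq.continuous_fderiv one_ne_zero).clm_apply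
      ((hK.continuous.comp continuous_snd).prodMk continuous_const)
  have hvc := hv.continuous
  have key : ∫ p in spaceTimeCylinder Ω τ,
        (a₀ ^ 2 / 2 * s ^ 2 * (w p * v p ^ 2) - w p * Av p ^ 2) ≤
      ∫ p in spaceTimeCylinder Ω τ, s * fderiv ℝ q p (K p.2, 1) := by
    refine setIntegral_mono_on (hΩ.integrableOn_cylinder (by fun_prop))
      (hΩ.integrableOn_cylinder (by fun_prop)) hΩ.measurableSet_cylinder fun p hp => ?_
    have hp' := IsSmoothBoundedDomain.cylinder_subset hp
    rw [fderiv_weighted_sq hK x₀ β s hv p]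
    have hap : a₀ ≤ a p := hpos p.1 hp'.1 p.2 hp'.2
    have hDap : -M ≤ fderiv ℝ a p (K p.2, 1) := (abs_le.1 (hM p hp')).1
    have hwp : 0 < w p := Real.exp_pos _
    have h1 : a₀ ^ 2 / 2 * s ^ 2 * v p ^ 2 - Av p ^ 2 ≤
        s * (fderiv ℝ a p (K p.2, 1) * v p ^ 2 + 2 * s * a p ^ 2 * v p ^ 2 +
          2 * a p * v p * Av p) := by
      have h2 : a₀ ^ 2 ≤ a p ^ 2 := by gcongr
      have h3 : -M * v p ^ 2 ≤ fderiv ℝ a p (K p.2, 1) * v p ^ 2 := by gcongr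
      have h4 : a₀ ^ 2 * (s ^ 2 * v p ^ 2) ≤ a p ^ 2 * (s ^ 2 * v p ^ 2) := by gcongr
      have h5 : 2 * M * (s * v p ^ 2) ≤ a₀ ^ 2 * s * (s * v p ^ 2) := by gcongr
      have h6 : s * (-M * v p ^ 2) ≤ s * (fderiv ℝ a p (K p.2, 1) * v p ^ 2) := by gcongr
      -- Completing the square bounds the cross term: 2 s a v Av ≥ −s² a² v² − (Av)², which costs
      -- half of 2 s² a² v².
      nlinarith [sq_nonneg (s * a p * v p + Av p)]
    calc _ = w p * (a₀ ^ 2 / 2 * s ^ 2 * v p ^ 2 - Av p ^ 2) := by ring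
      _ ≤ w p * (s * (fderiv ℝ a p (K p.2, 1) * v p ^ 2 + 2 * s * a p ^ 2 * v p ^ 2 +
          2 * a p * v p * Av p)) := by gcongr
      _ = _ := by ring
  rw [integral_const_mul, hΩ.integral_transport hτ hK.continuous hq, integral_sub
    (hΩ.integrableOn_cylinder (by fun_prop)) (hΩ.integrableOn_cylinder (by fun_prop)),
    integral_const_mul] at key
  -- The contribution of t = 0 enters with a minus sign, so positivity of `a` lets it be discarded.
  have h0 : 0 ≤ ∫ x in Ω, q (x, 0) := by
    refine setIntegral_nonneg hΩ.isOpen.measurableSet fun x hx => ?_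
    have := ha₀.le.trans (hpos x (subset_closure hx) 0 ⟨le_rfl, hτ.le⟩)
    have hwp : 0 < w (x, 0) := Real.exp_pos _
    positivity
  have hint : ∀ f : SpaceTime d → ℝ, Continuous f → IntegrableOn (fun x => f (x, τ)) Ω := fun f hf =>
    ((hf.comp (by fun_prop : Continuous fun x : Space d =>
      (x, τ))).continuousOn.integrableOn_compact hΩ.isCompact_closure).mono_set subset_closure
  have h1 : ∫ x in Ω, q (x, τ) ≤ a₁ * ∫ x in Ω, w (x, τ) * v (x, τ) ^ 2 := by
    rw [← integral_const_mul]
    refine setIntegral_mono_on (hint q hq.continuous)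
      (hint (fun p => a₁ * (w p * v p ^ 2)) (by fun_prop)) hΩ.isOpen.measurableSet fun x hx => ?_
    have hwp : 0 < w (x, τ) := Real.exp_pos _
    have := (le_abs_self _).trans (ha₁ (x, τ) ⟨subset_closure hx, hτ.le, le_rfl⟩)
    calc q (x, τ) = a (x, τ) * (w (x, τ) * v (x, τ) ^ 2) := by simp only [q]; ring
      _ ≤ _ := by gcongr
  have h2 : ∫ p, q p * ⟪K p.2, outerNormal Ω p.1⟫ ∂lateralMeasure Ω τ =
      ∫ p, w p * a p * ⟪K p.2, outerNormal Ω p.1⟫ * v p ^ 2 ∂lateralMeasure Ω τ := by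
    refine integral_congr_ae (Eventually.of_forall fun p => ?_)
    simp only [q]; ring
  rw [h2] at key
  set I := ∫ p in spaceTimeCylinder Ω τ, w p * v p ^ 2
  set I' := ∫ p in spaceTimeCylinder Ω τ, w p * Av p ^ 2
  set B := ∫ p, w p * a p * ⟪K p.2, outerNormal Ω p.1⟫ * v p ^ 2 ∂lateralMeasure Ω τ
  set T := ∫ x in Ω, w (x, τ) * v (x, τ) ^ 2
  have h3 : a₀ ^ 2 / 2 * s ^ 2 * I ≤ I' + s * B + s * (a₁ * T) := by
    have : s * (∫ x in Ω, q (x, τ)) ≤ s * (a₁ * T) := by gcongr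
    have h5 : 0 ≤ s * ∫ x in Ω, q (x, 0) := by positivity
    linarith
  calc s ^ 2 * I = 2 / a₀ ^ 2 * (a₀ ^ 2 / 2 * s ^ 2 * I) := by field_simp
    _ ≤ 2 / a₀ ^ 2 * (I' + s * B + s * (a₁ * T)) := by gcongr
    _ = _ := by ring

end SmoothEstimate

/-! ### Convergence in L² and weighted integrals of squares. -/

section L2Limits

variable {X : Type*} [MeasurableSpace X] {μ : Measure X}

theorem tendsto_eLpNorm_sub_of_tendsto {F : Type*} [NormedAddCommGroup F] {f g : ℕ → X → F}
    {u : X → F} (hf : ∀ n, AEStronglyMeasurable (f n) μ) (hg : ∀ n, AEStronglyMeasurable (g n) μ)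
    (hu : AEStronglyMeasurable u μ)
    (hfu : Tendsto (fun n => eLpNorm (fun x => f n x - u x) 2 μ) atTop (𝓝 0))
    (hgu : Tendsto (fun n => eLpNorm (fun x => g n x - u x) 2 μ) atTop (𝓝 0)) :
    Tendsto (fun n => eLpNorm (fun x => f n x - g n x) 2 μ) atTop (𝓝 0) := by
  have h : Tendsto (fun n => eLpNorm (fun x => f n x - u x) 2 μ + eLpNorm (fun x => g n x - u x) 2 μ)
      atTop (𝓝 0) := by simpa using hfu.add hgu
  refine tendsto_of_tendsto_of_tendsto_of_le_of_le tendsto_const_nhds h (fun _ => zero_le)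
    fun n => ?_
  have h1 : (fun x => f n x - g n x) = (fun x => f n x - u x) - fun x => g n x - u x := by
    ext x; simp
  simp only
  rw [h1]
  exact eLpNorm_sub_le ((hf n).sub hu) ((hg n).sub hu) (by norm_num)

theorem tendsto_eLpNorm_sub_trans {F : Type*} [NormedAddCommGroup F] {f g : ℕ → X → F}
    {u : X → F} (hf : ∀ n, AEStronglyMeasurable (f n) μ) (hg : ∀ n, AEStronglyMeasurable (g n) μ)
    (hu : AEStronglyMeasurable u μ)
    (hfg : Tendsto (fun n => eLpNorm (fun x => f n x - g n x) 2 μ) atTop (𝓝 0))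
    (hgu : Tendsto (fun n => eLpNorm (fun x => g n x - u x) 2 μ) atTop (𝓝 0)) :
    Tendsto (fun n => eLpNorm (fun x => f n x - u x) 2 μ) atTop (𝓝 0) := by
  have h : Tendsto (fun n => eLpNorm (fun x => f n x - g n x) 2 μ +
      eLpNorm (fun x => g n x - u x) 2 μ) atTop (𝓝 0) := by simpa using hfg.add hgu
  refine tendsto_of_tendsto_of_tendsto_of_le_of_le tendsto_const_nhds h (fun _ => zero_le)
    fun n => ?_
  have h1 : (fun x => f n x - u x) = (fun x => f n x - g n x) + fun x => g n x - u x := by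
    ext x; simp
  simp only
  rw [h1]
  exact eLpNorm_add_le ((hf n).sub (hg n)) ((hg n).sub hu) (by norm_num)

/-- Weighted integrals of squares are continuous in `L²`. -/
theorem tendsto_integral_mul_sq {w : X → ℝ} (hw : AEStronglyMeasurable w μ) {C : ℝ}
    (hC : ∀ᵐ x ∂μ, ‖w x‖ ≤ C) {f : ℕ → X → ℝ} {u : X → ℝ}
    (hf : ∀ n, AEStronglyMeasurable (f n) μ) (hu : MemLp u 2 μ)
    (hfu : Tendsto (fun n => eLpNorm (fun x => f n x - u x) 2 μ) atTop (𝓝 0)) :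
    Tendsto (fun n => ∫ x, w x * f n x ^ 2 ∂μ) atTop (𝓝 (∫ x, w x * u x ^ 2 ∂μ)) := by
  have hint : ∀ g : X → ℝ, MemLp g 2 μ → Integrable (fun x => w x * g x ^ 2) μ := fun g hg =>
    hg.integrable_sq.bdd_mul hw hC
  -- The functions `f n` are only assumed measurable; they lie in L² as soon as their distance to
  -- `u` is finite.
  have hev : ∀ᶠ n in atTop, Integrable (fun x => w x * f n x ^ 2) μ := by
    filter_upwards [hfu.eventually (gt_mem_nhds (ENNReal.zero_lt_top))] with n hn
    have h1 : MemLp (fun x => f n x - u x) 2 μ := ⟨(hf n).sub hu.1, hn⟩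
    have h2 := h1.add hu
    refine hint _ ?_
    convert h2 using 1
    ext x; simp
  refine tendsto_integral_of_L1' _ (hint u hu).1 hev ?_
  -- Factor f² − u² = (f − u)((f − u) + 2u) and apply Hölder's inequality; the second factor stays
  -- bounded.
  have hlim : Tendsto (fun n => ENNReal.ofReal C * (eLpNorm (fun x => f n x - u x) 2 μ *
      (eLpNorm (fun x => f n x - u x) 2 μ + (eLpNorm u 2 μ + eLpNorm u 2 μ)))) atTop (𝓝 0) := by
    have h1 : Tendsto (fun n => eLpNorm (fun x => f n x - u x) 2 μ +
        (eLpNorm u 2 μ + eLpNorm u 2 μ)) atTop (𝓝 (0 + (eLpNorm u 2 μ + eLpNorm u 2 μ))) :=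
      hfu.add tendsto_const_nhds
    have h2 := ENNReal.Tendsto.mul hfu (Or.inr (by
      rw [zero_add]; exact ENNReal.add_ne_top.2 ⟨hu.2.ne, hu.2.ne⟩)) h1 (Or.inr (by simp))
    have h3 := ENNReal.Tendsto.const_mul h2 (Or.inr (ENNReal.ofReal_ne_top (r := C)))
    simpa using h3
  refine tendsto_of_tendsto_of_tendsto_of_le_of_le tendsto_const_nhds hlim (fun _ => zero_le)
    fun n => ?_
  have hfn : AEStronglyMeasurable (fun x => f n x - u x) μ := (hf n).sub hu.1
  have h1 : eLpNorm ((fun x => w x * f n x ^ 2) - fun x => w x * u x ^ 2) 1 μ ≤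
      ENNReal.ofReal C * eLpNorm ((fun x => f n x - u x) • ((fun x => f n x - u x) + (u + u))) 1 μ := by
    refine eLpNorm_le_mul_eLpNorm_of_ae_le_mul ?_ 1
    filter_upwards [hC] with x hx
    have : w x * f n x ^ 2 - w x * u x ^ 2 = w x * ((f n x - u x) * (f n x - u x + (u x + u x))) := by
      ring
    simp only [Pi.sub_apply, Pi.smul_apply', Pi.add_apply, smul_eq_mul]
    rw [this, norm_mul]
    gcongr
  refine h1.trans (mul_le_mul_right ?_ _)
  refine (eLpNorm_smul_le_mul_eLpNorm (p := 2) (q := 2) (r := 1)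
    (hfn.add (hu.1.add hu.1)) hfn).trans (mul_le_mul_right ?_ _)
  refine (eLpNorm_add_le hfn (hu.1.add hu.1) (by norm_num)).trans (add_le_add_right ?_ _)
  exact eLpNorm_add_le hu.1 hu.1 (by norm_num)

theorem tendsto_integral_sq_zero {f : ℕ → X → ℝ} (hf : ∀ n, AEStronglyMeasurable (f n) μ)
    (h : Tendsto (fun n => eLpNorm (f n) 2 μ) atTop (𝓝 0)) :
    Tendsto (fun n => ∫ x, f n x ^ 2 ∂μ) atTop (𝓝 0) := by
  have := tendsto_integral_mul_sq (μ := μ) (w := fun _ => 1) aestronglyMeasurable_const (C := 1)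
    (by simp) hf (u := fun _ => 0) MemLp.zero' (by simpa using h)
  simpa using this

theorem tendsto_eLpNorm_zero_of_integral_sq {f : ℕ → X → ℝ} (hf : ∀ n, MemLp (f n) 2 μ)
    (h : Tendsto (fun n => ∫ x, f n x ^ 2 ∂μ) atTop (𝓝 0)) :
    Tendsto (fun n => eLpNorm (f n) 2 μ) atTop (𝓝 0) := by
  have h1 : ∀ n, eLpNorm (f n) 2 μ = ENNReal.ofReal (Real.sqrt (∫ x, f n x ^ 2 ∂μ)) := fun n => by
    rw [(hf n).eLpNorm_eq_integral_rpow_norm (by norm_num) (by norm_num), Real.sqrt_eq_rpow]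
    simp
  simp_rw [h1]
  have h2 := (Real.continuous_sqrt.tendsto 0).comp h
  have h3 := (ENNReal.continuous_ofReal.tendsto _).comp h2
  simpa [Function.comp_def] using h3

end L2Limits

/-! ### The final trace and convergence of the transport term. -/

section Traces

variable {d : ℕ} {Ω : Set (Space d)} {τ : ℝ}

theorem continuous_spaceGrad {f : SpaceTime d → ℝ} (hf : ContDiff ℝ 1 f) :
    Continuous (spaceGrad f) := by
  have h : spaceGrad f = fun p => (InnerProductSpace.toDual ℝ (Space d)).symm
      ((fderiv ℝ f p).comp (.inl ℝ (Space d) ℝ)) := by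
    funext p
    refine ext_inner_left ℝ fun k => ?_
    rw [inner_spaceGrad (hf.differentiable one_ne_zero p), real_inner_comm,
      InnerProductSpace.toDual_symm_apply]
    simp
  rw [h]
  exact (LinearIsometryEquiv.continuous _).comp
    ((hf.continuous_fderiv one_ne_zero).clm_comp continuous_const)

/-- The trace inequality at the final time. -/
theorem IsSmoothBoundedDomain.integral_final_sq_le (hΩ : IsSmoothBoundedDomain Ω) (hτ : 0 < τ)
    {v : SpaceTime d → ℝ} (hv : ContDiff ℝ 1 v) :
    τ * ∫ x in Ω, v (x, τ) ^ 2 ≤ (1 + τ) * (∫ p in spaceTimeCylinder Ω τ, v p ^ 2) +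
      τ * ∫ p in spaceTimeCylinder Ω τ, timeDeriv v p ^ 2 := by
  -- The multiplier t vanishes at t = 0, so only the values at t = τ survive integration in time.
  have hq : ContDiff ℝ 1 fun p : SpaceTime d => p.2 * v p ^ 2 := contDiff_snd.mul (hv.pow 2)
  have h := hΩ.integral_timeDeriv hτ hq
  have hvt := continuous_timeDeriv hv
  have hvc := hv.continuous
  have hd : ∀ p : SpaceTime d, fderiv ℝ (fun p : SpaceTime d => p.2 * v p ^ 2) p (0, 1) =
      v p ^ 2 + 2 * p.2 * v p * timeDeriv v p := fun p => by
    have h3 := hv.differentiable one_ne_zero p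
    rw [timeDeriv_eq_fderiv h3]
    have h4 : HasFDerivAt (fun p : SpaceTime d => p.2 * v p ^ 2) _ p :=
      hasFDerivAt_snd.mul (h3.hasFDerivAt.pow 2)
    rw [h4.fderiv]
    simp
    ring
  simp only [hd, zero_mul, integral_zero, sub_zero, integral_const_mul] at h
  rw [← h, ← integral_const_mul, ← integral_const_mul, ← integral_add
    (hΩ.integrableOn_cylinder (by fun_prop)) (hΩ.integrableOn_cylinder (by fun_prop))]
  refine setIntegral_mono_on (hΩ.integrableOn_cylinder (by fun_prop))
    (hΩ.integrableOn_cylinder (by fun_prop)) hΩ.measurableSet_cylinder fun p hp => ?_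
  have hp2 : p.2 ∈ Ioo 0 τ := hp.2
  have h1 : p.2 * (2 * v p * timeDeriv v p) ≤ p.2 * (v p ^ 2 + timeDeriv v p ^ 2) :=
    mul_le_mul_of_nonneg_left (by nlinarith [sq_nonneg (v p - timeDeriv v p)]) hp2.1.le
  have h2 : p.2 * (v p ^ 2 + timeDeriv v p ^ 2) ≤ τ * (v p ^ 2 + timeDeriv v p ^ 2) :=
    mul_le_mul_of_nonneg_right hp2.2.le (by positivity)
  linarith

/-- The final trace does not depend on the approximating sequence. -/
theorem IsFinalTrace.tendsto (hΩ : IsSmoothBoundedDomain Ω) (hτ : 0 < τ) {u : SpaceTime d → ℝ}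
    {gx : SpaceTime d → Space d} {gt : SpaceTime d → ℝ}
    (hu : IsH1 (spaceTimeCylinder Ω τ) u gx gt) {uFin : Space d → ℝ}
    (hFin : IsFinalTrace Ω τ u gx gt uFin) {v : ℕ → SpaceTime d → ℝ}
    (hv : ∀ n, ContDiff ℝ 1 (v n)) (hvu : TendstoH1 (spaceTimeCylinder Ω τ) v u gx gt) :
    Tendsto (fun n => eLpNorm (fun x => v n (x, τ) - uFin x) 2 (volume.restrict Ω)) atTop (𝓝 0) := by
  obtain ⟨hmem, v', hv'', hvu', hFin'⟩ := hFin
  have hv' : ∀ n, ContDiff ℝ 1 (v' n) := fun n => (hv'' n).of_le (by exact_mod_cast le_top)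
  have hslice : Continuous fun x : Space d => (x, τ) := by fun_prop
  -- The difference of the two approximating sequences, together with its time derivative, tends to
  -- zero in L²; by the trace inequality so do its values at t = τ.
  set z : ℕ → SpaceTime d → ℝ := fun n p => v n p - v' n p
  have hz : ∀ n, ContDiff ℝ 1 (z n) := fun n => (hv n).sub (hv' n)
  have hzt : ∀ n, timeDeriv (z n) = fun p => timeDeriv (v n) p - timeDeriv (v' n) p := fun n => by
    funext p
    have h1 := (hv n).differentiable one_ne_zero p
    have h2 := (hv' n).differentiable one_ne_zero p
    exact ((hasDerivAt_time h1).sub (hasDerivAt_time h2)).deriv.trans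
      (by rw [timeDeriv_eq_fderiv h1, timeDeriv_eq_fderiv h2])
  have l1 := tendsto_integral_sq_zero (fun n => (hz n).continuous.aestronglyMeasurable)
    (tendsto_eLpNorm_sub_of_tendsto (fun n => (hv n).continuous.aestronglyMeasurable)
      (fun n => (hv' n).continuous.aestronglyMeasurable) hu.memLp.1 hvu.1 hvu'.1)
  have l2 := tendsto_integral_sq_zero
    (fun n => ((continuous_timeDeriv (hv n)).sub (continuous_timeDeriv (hv' n))).aestronglyMeasurable)
    (tendsto_eLpNorm_sub_of_tendsto (fun n => (continuous_timeDeriv (hv n)).aestronglyMeasurable)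
      (fun n => (continuous_timeDeriv (hv' n)).aestronglyMeasurable) hu.memLp_time.1 hvu.2.2 hvu'.2.2)
  have l3 : Tendsto (fun n => ∫ x in Ω, z n (x, τ) ^ 2) atTop (𝓝 0) := by
    have h3 : Tendsto (fun n => τ⁻¹ * ((1 + τ) * (∫ p in spaceTimeCylinder Ω τ, z n p ^ 2) +
        τ * ∫ p in spaceTimeCylinder Ω τ, timeDeriv (z n) p ^ 2)) atTop (𝓝 0) := by
      simp only [hzt]
      simpa using ((l1.const_mul (1 + τ)).add (l2.const_mul τ)).const_mul τ⁻¹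
    refine tendsto_of_tendsto_of_tendsto_of_le_of_le tendsto_const_nhds h3
      (fun n => integral_nonneg fun x => sq_nonneg _) fun n => ?_
    simp only
    rw [inv_mul_eq_div, le_div_iff₀ hτ, mul_comm]
    exact hΩ.integral_final_sq_le hτ (hz n)
  have hmemz : ∀ n, MemLp (fun x => z n (x, τ)) 2 (volume.restrict Ω) := fun n => by
    have hc : Continuous fun x => z n (x, τ) := (hz n).continuous.comp hslice
    refine (memLp_two_iff_integrable_sq hc.aestronglyMeasurable).2 ?_
    exact ((hc.pow 2).continuousOn.integrableOn_compact hΩ.isCompact_closure).mono_set subset_closure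
  exact tendsto_eLpNorm_sub_trans
    (fun n => ((hv n).continuous.comp hslice).aestronglyMeasurable)
    (fun n => ((hv' n).continuous.comp hslice).aestronglyMeasurable) hmem.1
    (tendsto_eLpNorm_zero_of_integral_sq hmemz l3) hFin'

theorem IsSmoothBoundedDomain.exists_norm_le (hΩ : IsSmoothBoundedDomain Ω) {F : Type*}
    [NormedAddCommGroup F] {f : SpaceTime d → F} (hf : Continuous f) :
    ∃ C, ∀ᵐ p ∂(volume.restrict (spaceTimeCylinder Ω τ)), ‖f p‖ ≤ C := by
  obtain ⟨C, hC⟩ := (hΩ.isCompact_cylinder (τ := τ)).exists_bound_of_continuousOn hf.continuousOn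
  refine ⟨C, ?_⟩
  filter_upwards [ae_restrict_mem hΩ.measurableSet_cylinder] with p hp
  exact hC p (cylinder_subset hp)

theorem memLp_inner_curve (hΩ : IsSmoothBoundedDomain Ω) {K : ℝ → Space d} (hK : Continuous K)
    {g : SpaceTime d → Space d} (hg : MemLp g 2 (volume.restrict (spaceTimeCylinder Ω τ))) :
    MemLp (fun p => ⟪K p.2, g p⟫) 2 (volume.restrict (spaceTimeCylinder Ω τ)) := by
  obtain ⟨C, hC⟩ := hΩ.exists_norm_le (τ := τ) (hK.comp continuous_snd)
  refine hg.of_le_mul (c := C) ((hK.comp continuous_snd).aestronglyMeasurable.inner hg.1) ?_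
  filter_upwards [hC] with p hp
  exact (norm_inner_le_norm _ _).trans (by gcongr; exact hp)

theorem tendsto_transport (hΩ : IsSmoothBoundedDomain Ω) {K : ℝ → Space d} (hK : Continuous K)
    {u : SpaceTime d → ℝ} {gx : SpaceTime d → Space d} {gt : SpaceTime d → ℝ}
    (hu : IsH1 (spaceTimeCylinder Ω τ) u gx gt) {v : ℕ → SpaceTime d → ℝ}
    (hv : ∀ n, ContDiff ℝ 1 (v n)) (hvu : TendstoH1 (spaceTimeCylinder Ω τ) v u gx gt) :
    Tendsto (fun n => eLpNorm (fun p => transport K (spaceGrad (v n)) (timeDeriv (v n)) p -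
      transport K gx gt p) 2 (volume.restrict (spaceTimeCylinder Ω τ))) atTop (𝓝 0) := by
  obtain ⟨C, hC⟩ := hΩ.exists_norm_le (τ := τ) (hK.comp continuous_snd)
  have hlim := hvu.2.2.add (ENNReal.Tendsto.const_mul hvu.2.1
    (Or.inr (ENNReal.ofReal_ne_top (r := C))))
  rw [mul_zero, add_zero] at hlim
  refine tendsto_of_tendsto_of_tendsto_of_le_of_le tendsto_const_nhds hlim (fun _ => zero_le)
    fun n => ?_
  have hm1 : AEStronglyMeasurable (fun p => timeDeriv (v n) p - gt p)
      (volume.restrict (spaceTimeCylinder Ω τ)) :=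
    (continuous_timeDeriv (hv n)).aestronglyMeasurable.sub hu.memLp_time.1
  have hm2 : AEStronglyMeasurable (fun p => spaceGrad (v n) p - gx p)
      (volume.restrict (spaceTimeCylinder Ω τ)) :=
    (continuous_spaceGrad (hv n)).aestronglyMeasurable.sub hu.memLp_grad.1
  have heq : (fun p => transport K (spaceGrad (v n)) (timeDeriv (v n)) p - transport K gx gt p) =
      (fun p => timeDeriv (v n) p - gt p) + fun p => ⟪K p.2, spaceGrad (v n) p - gx p⟫ := by
    ext p
    simp only [transport, Pi.add_apply, inner_sub_right]
    ring
  simp only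
  rw [heq]
  refine (eLpNorm_add_le hm1 ((hK.comp continuous_snd).aestronglyMeasurable.inner hm2)
    (by norm_num)).trans (add_le_add_right ?_ _)
  refine eLpNorm_le_mul_eLpNorm_of_ae_le_mul ?_ 2
  filter_upwards [hC] with p hp
  exact (norm_inner_le_norm _ _).trans (by gcongr)

end Traces

/-! ### Passage from smooth functions to H¹. -/

section Estimate

variable {d : ℕ} {Ω : Set (Space d)} {τ : ℝ}

/-- The Carleman estimate for `H¹` functions and a globally defined `C¹` velocity. -/
theorem carleman_estimate (hΩ : IsSmoothBoundedDomain Ω) (hτ : 0 < τ)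
    {K : ℝ → Space d} (hK : ContDiff ℝ 1 K) {x₀ : Space d} {β a₀ : ℝ} (ha₀ : 0 < a₀)
    (hpos : ∀ x ∈ closure Ω, ∀ t ∈ Icc 0 τ, a₀ ≤ transportWeight K x₀ β (x, t)) :
    ∃ sStar : ℝ, 0 < sStar ∧ ∃ C : ℝ, 0 < C ∧ ∃ C' : ℝ, 0 < C' ∧
      ∀ s : ℝ, sStar < s →
      ∀ (u : SpaceTime d → ℝ) (gx : SpaceTime d → Space d) (gt : SpaceTime d → ℝ),
        IsH1 (spaceTimeCylinder Ω τ) u gx gt →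
      ∀ (uLat : SpaceTime d → ℝ) (uFin : Space d → ℝ),
        IsLateralTrace Ω τ u gx gt uLat → IsFinalTrace Ω τ u gx gt uFin →
        s ^ 2 * ∫ p in spaceTimeCylinder Ω τ, Real.exp (2 * s * weight x₀ β p) * u p ^ 2 ≤
          C * (∫ p in spaceTimeCylinder Ω τ,
              Real.exp (2 * s * weight x₀ β p) * transport K gx gt p ^ 2) +
          C * s * (∫ p, Real.exp (2 * s * weight x₀ β p) * transportWeight K x₀ β p *
              ⟪K p.2, outerNormal Ω p.1⟫ * uLat p ^ 2 ∂(lateralMeasure Ω τ)) +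
          C' * s * (∫ x in Ω,
              Real.exp (2 * s * weight x₀ β (x, τ)) * uFin x ^ 2) := by
  obtain ⟨sStar, hs, C, hC, C', hC', h⟩ := carleman_estimate_of_contDiff hΩ hτ hK ha₀ hpos
  refine ⟨sStar, hs, C, hC, C', hC', fun s hss u gx gt hu uLat uFin hLat hFin => ?_⟩
  obtain ⟨hLmem, v, hv', hvu, hvL⟩ := hLat
  have hv : ∀ n, ContDiff ℝ 1 (v n) := fun n => (hv' n).of_le (by exact_mod_cast le_top)
  -- The sequence witnessing the lateral trace is made to compute the final trace too, so that all
  -- four integrals converge along one sequence.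
  have hvF := hFin.tendsto hΩ hτ hu hv hvu
  have hψ := (contDiff_weight x₀ β (n := 1)).continuous
  have ha := (contDiff_transportWeight hK x₀ β).continuous
  have hw : Continuous fun p => Real.exp (2 * s * weight x₀ β p) := by fun_prop
  have hwF : Continuous fun x : Space d => Real.exp (2 * s * weight x₀ β (x, τ)) := by fun_prop
  have hwa : Continuous fun p => Real.exp (2 * s * weight x₀ β p) * transportWeight K x₀ β p := by
    fun_prop
  obtain ⟨Cw, hCw⟩ := hΩ.exists_norm_le (τ := τ) hw
  obtain ⟨CL, hCL⟩ := hΩ.exists_bound_lateral (τ := τ) hwa hK.continuous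
  obtain ⟨CF, hCF⟩ := hΩ.isCompact_closure.exists_bound_of_continuousOn hwF.continuousOn
  have t1 := tendsto_integral_mul_sq hw.aestronglyMeasurable hCw
    (fun n => (hv n).continuous.aestronglyMeasurable) hu.memLp hvu.1
  have hAv : ∀ n, Continuous (transport K (spaceGrad (v n)) (timeDeriv (v n))) := fun n =>
    (continuous_timeDeriv (hv n)).add
      ((hK.continuous.comp continuous_snd).inner (continuous_spaceGrad (hv n)))
  have t2 := tendsto_integral_mul_sq hw.aestronglyMeasurable hCw
    (fun n => (hAv n).aestronglyMeasurable)
    (hu.memLp_time.add (memLp_inner_curve hΩ hK.continuous hu.memLp_grad))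
    (tendsto_transport hΩ hK.continuous hu hv hvu)
  have t3 := tendsto_integral_mul_sq (hΩ.aestronglyMeasurable_lateral hwa hK.continuous) hCL
    (fun n => (hv n).continuous.aestronglyMeasurable) hLmem hvL
  have t4 := tendsto_integral_mul_sq (μ := volume.restrict Ω) hwF.aestronglyMeasurable (C := CF)
    (by
      filter_upwards [ae_restrict_mem hΩ.isOpen.measurableSet] with x hx
      exact hCF x (subset_closure hx))
    (fun n => ((hv n).continuous.comp (by fun_prop : Continuous fun x : Space d =>
      (x, τ))).aestronglyMeasurable) hFin.1 hvF
  exact le_of_tendsto_of_tendsto' (t1.const_mul (s ^ 2))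
    (((t2.const_mul C).add (t3.const_mul (C * s))).add (t4.const_mul (C' * s)))
    fun n => h s hss (v n) (hv n)

end Estimate

end CarlemanTransport

/-! ### Positivity of Aψ and reduction to a globally defined velocity. -/

open CarlemanTransport
theorem proposition4p3 {d : ℕ} (hd : 0 < d) (Ω : Set (Space d)) (hΩ : IsSmoothBoundedDomain Ω)
    (τ : ℝ) (hτ : 0 < τ) (c₀ : ℝ) (hc₀ : c₀ ∈ Ioo (1 / Real.sqrt 2) 1)
    (H : ℝ → Space d) (hH : ContDiffOn ℝ 1 H (Icc 0 τ))
    (ρ : ℝ) (hρ : 0 < ρ) (hHρ : ∀ t ∈ Icc 0 τ, ρ ≤ ‖H t‖)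
    (θ₀ : Space d) (hθ₀ : ‖θ₀‖ = 1) (hHθ₀ : ∀ t ∈ Icc 0 τ, c₀ ≤ ⟪H t, θ₀⟫ / ‖H t‖)
    (x₀ : Space d) (hx₀ : x₀ ∉ closure Ω)
    (hHx₀ : ∀ x ∈ closure Ω, ∀ t ∈ Icc 0 τ,
      2 * c₀ ^ 2 - 1 ≤ ⟪H t, x - x₀⟫ / (‖H t‖ * ‖x - x₀‖))
    (β : ℝ) (hβ : 0 < β) (hβδ : β < 2 * (ρ * (2 * c₀ ^ 2 - 1) * Metric.infDist x₀ Ω)) :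
    ∃ sStar : ℝ, 0 < sStar ∧ ∃ C : ℝ, 0 < C ∧ ∃ C' : ℝ, 0 < C' ∧
      ∀ s : ℝ, sStar < s →
      ∀ (u : SpaceTime d → ℝ) (gx : SpaceTime d → Space d) (gt : SpaceTime d → ℝ),
        IsH1 (spaceTimeCylinder Ω τ) u gx gt →
      ∀ (uLat : SpaceTime d → ℝ) (uFin : Space d → ℝ),
        IsLateralTrace Ω τ u gx gt uLat → IsFinalTrace Ω τ u gx gt uFin →
        s ^ 2 * ∫ p in spaceTimeCylinder Ω τ, Real.exp (2 * s * weight x₀ β p) * |u p| ^ 2 ≤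
          C * (∫ p in spaceTimeCylinder Ω τ,
              Real.exp (2 * s * weight x₀ β p) * |transport H gx gt p| ^ 2) +
          C * s * (∫ p, Real.exp (2 * s * weight x₀ β p) * transportWeight H x₀ β p *
              ⟪H p.2, outerNormal Ω p.1⟫ * |uLat p| ^ 2 ∂(lateralMeasure Ω τ)) +
          C' * s * (∫ x in Ω,
              Real.exp (2 * s * weight x₀ β (x, τ)) * |uFin x| ^ 2) := by
  obtain ⟨K, hK, hKH⟩ := exists_contDiff_extension hτ hH
  -- Makes 2c₀² − 1 positive, so the angle condition can be multiplied by lower bounds for ‖H t‖ and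
  -- ‖x − x₀‖.
  have hsq : 1 / 2 < c₀ ^ 2 := by
    have h1 : (1 / Real.sqrt 2) ^ 2 = 1 / 2 := by
      rw [div_pow, Real.sq_sqrt (by norm_num)]; norm_num
    rw [← h1]
    exact pow_lt_pow_left₀ hc₀.1 (by positivity) two_ne_zero
  have hpos : ∀ x ∈ closure Ω, ∀ t ∈ Icc 0 τ,
      2 * (ρ * (2 * c₀ ^ 2 - 1) * Metric.infDist x₀ Ω) - β ≤ transportWeight K x₀ β (x, t) := by
    intro x hx t ht
    rw [transportWeight_eq, hKH ht]
    have hHt := hHρ t ht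
    have hdist : Metric.infDist x₀ Ω ≤ ‖x - x₀‖ := by
      rw [← Metric.infDist_closure, ← dist_eq_norm, dist_comm]
      exact Metric.infDist_le_dist_of_mem hx
    have hne : 0 < ‖x - x₀‖ := norm_pos_iff.2 (sub_ne_zero.2 fun h => hx₀ (h ▸ hx))
    have h1 := hHx₀ x hx t ht
    rw [le_div_iff₀ (mul_pos (hρ.trans_le hHt) hne)] at h1
    have h2 : (2 * c₀ ^ 2 - 1) * (ρ * Metric.infDist x₀ Ω) ≤
        (2 * c₀ ^ 2 - 1) * (‖H t‖ * ‖x - x₀‖) :=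
      mul_le_mul_of_nonneg_left (mul_le_mul hHt hdist Metric.infDist_nonneg (norm_nonneg _))
        (by linarith)
    simp only
    linarith
  obtain ⟨sStar, hs, C, hC, C', hC', h⟩ := carleman_estimate hΩ hτ hK (by linarith) hpos
  refine ⟨sStar, hs, C, hC, C', hC', fun s hss u gx gt hu uLat uFin hLat hFin => ?_⟩
  simp only [sq_abs]
  -- The integrals only see times in (0, τ), and `transportWeight` involves the velocity through its
  -- value alone, so `H` and its extension `K` are interchangeable.
  have e1 : ∫ p in spaceTimeCylinder Ω τ, Real.exp (2 * s * weight x₀ β p) *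
        transport H gx gt p ^ 2 =
      ∫ p in spaceTimeCylinder Ω τ, Real.exp (2 * s * weight x₀ β p) *
        transport K gx gt p ^ 2 := by
    refine setIntegral_congr_fun hΩ.measurableSet_cylinder fun p hp => ?_
    simp only [transport, hKH (Ioo_subset_Icc_self hp.2)]
  have e2 : ∫ p, Real.exp (2 * s * weight x₀ β p) * transportWeight H x₀ β p *
        ⟪H p.2, outerNormal Ω p.1⟫ * uLat p ^ 2 ∂(lateralMeasure Ω τ) =
      ∫ p, Real.exp (2 * s * weight x₀ β p) * transportWeight K x₀ β p *
        ⟪K p.2, outerNormal Ω p.1⟫ * uLat p ^ 2 ∂(lateralMeasure Ω τ) := by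
    refine integral_congr_ae ?_
    filter_upwards [hΩ.ae_lateralMeasure_mem] with p hp
    simp only [transportWeight_eq, hKH (Ioo_subset_Icc_self hp.2)]
  rw [e1, e2]
  exact h s hss u gx gt hu uLat uFin hLat hFin
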